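/- Let $n\ge 1$, $\langle x,y\rangle=\sum_j x_j\overline{y_j}$ on $\mathbb C^n$, $\omega=\operatorname{Im}\langle\cdot,\cdot\rangle$, and let $G_n=U(n)\ltimes\mathbb H_n$ be the set $U(n)\times\mathbb C^n\times\mathbb R$ with the product $$(A,z,t)(B,z',t')=\bigl(AB,\;z+Az',\;t+t'-\tfrac12\omega(z,Az')\bigr).$$ Let $\mathfrak g_n=\mathfrak u(n)\ltimes\mathfrak h_n$ be its Lie algebra. Identify $\mathfrak g_n^*$ with $\mathfrak u(n)\times\mathbb C^n\times\mathbb R$ through $\langle (U,u,x),(B,w,s)\rangle=\operatorname{tr}(UB)+\omega(u,w)+xs$. The coadjoint action is then $$\mathrm{Ad}^*(A,z,t)(U,u,x)=\bigl(AUA^*+z\times(Au)+\tfrac x2\,z\times z,\;Au+xz,\;x\bigr),\qquad z\times w:=\tfrac i2(wz^*+zw^*).$$ Let $P_n$ be the set of $\lambda\in\mathbb Z^n$ with $\lambda_1\ge\dots\ge\lambda_n$ ($P_0$ is a single point). For $\lambda\in P_n$, $\alpha\in\mathbb R^*=\mathbb R\setminus\{0\}$, $\mu\in P_{n-1}$ and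 $r>0$, let $\mathcal O_{(\lambda,\alpha)}$, $\mathcal O_{(\mu,r)}$, $\mathcal O_\lambda$ be the coadjoint orbits of $$(\mathrm{diag}(i\lambda_1,\dots,i\lambda_n),0,\alpha),\quad (\mathrm{diag}(i\mu_1,\dots,i\mu_{n-1},0),(0,\dots,0,r)^T,0),\quad (\mathrm{diag}(i\lambda_1,\dots,i\lambda_n),0,0)$$ respectively. Let $\mathfrak g_n^\ddagger\subset\mathfrak g_n^*$ be the union of all these orbits, with the subspace topology, and give the orbit space $\mathfrak g_n^\ddagger/G_n$ the quotient topology. **Theorem.** Let $\alpha\in\mathbb R^*$, $r>0$, $\mu\in P_{n-1}$, $\lambda\in P_n$, and let $\lambda^k\in P_n$, $\alpha_k\in\mathbb R^*$, $\mu^k\in P_{n-1}$, $r_k>0$ ($k\in\mathbb N$) be sequences. In $\mathfrak g_n^\ddagger/G_n$ the following holds. 1. $\mathcal O_{(\lambda^k,\alpha_k)}\to\mathcal O_{(\lambda,\alpha)}$ if and only if $\alpha_k\to\alpha$ and $\lambda^k=\lambda$ for all large $k$. 2. $\mathcal O_{(\lambda^k,\alpha_k)}\to\mathcal O_{(\mu,r)}$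 if and only if $\alpha_k\to0$ and both of the following hold: (i) for all large $k$ with $\alpha_k>0$ one has $\lambda^k_j=\mu_j$ for $1\le j\le n-1$, and $\alpha_k\lambda^k_n\to-\frac{r^2}{2}$ as $k\to\infty$ along $\{k:\alpha_k>0\}$; (ii) for all large $k$ with $\alpha_k<0$ one has $\lambda^k_j=\mu_{j-1}$ for $2\le j\le n$, and $\alpha_k\lambda^k_1\to-\frac{r^2}{2}$ as $k\to\infty$ along $\{k:\alpha_k<0\}$. 3. $\mathcal O_{(\lambda^k,\alpha_k)}\to\mathcal O_{\lambda}$ if and only if $\alpha_k\to0$ and both of the following hold: (i) for all large $k$ with $\alpha_k>0$ one has $\lambda_1\ge\lambda^k_1\ge\lambda_2\ge\lambda^k_2\ge\dots\ge\lambda_n\ge\lambda^k_n$, and $\alpha_k\lambda^k_n\to0$ as $k\to\infty$ along $\{k:\alpha_k>0\}$; (ii) for all large $k$ with $\alpha_k<0$ one has $\lambda^k_1\ge\lambda_1\ge\lambda^k_2\ge\lambda_2\ge\dots\ge\lambda^k_n\ge\lambda_n$, and $\alpha_k\lambda^k_1\to0$ as $k\to\infty$ along $\{k:\alpha_k<0\}$.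 4. $\mathcal O_{(\mu^k,r_k)}\to\mathcal O_{(\mu,r)}$ if and only if $r_k\to r$ and $\mu^k=\mu$ for all large $k$. 5. $\mathcal O_{(\mu^k,r_k)}\to\mathcal O_{\lambda}$ if and only if $r_k\to0$ and $\lambda_1\ge\mu^k_1\ge\lambda_2\ge\mu^k_2\ge\dots\ge\lambda_{n-1}\ge\mu^k_{n-1}\ge\lambda_n$ for all large $k$. 6. $\mathcal O_{\lambda^k}\to\mathcal O_{\lambda}$ if and only if $\lambda^k=\lambda$ for all large $k$. In 2 and 3, a limit along a finite set of indices is no condition. In particular, if $\alpha_k>0$ for all large $k$ only (i) matters, and if $\alpha_k<0$ for all large $k$ only (ii) matters. -/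

import Mathlib

open Filter Topology Matrix

noncomputable section

namespace HeisenbergMotion

/-- The standard scalar product `⟨x, y⟩ = ∑ j, x j * conj (y j)` on `ℂⁿ`. -/
def scalar {n : ℕ} (x y : Fin n → ℂ) : ℂ := x ⬝ᵥ star y

/-- The symplectic form `ω = Im ⟨·, ·⟩` on `ℂⁿ`. -/
def symp {n : ℕ} (x y : Fin n → ℂ) : ℝ := (scalar x y).im

theorem symp_add_left {n : ℕ} (x y z : Fin n → ℂ) :
    symp (x + y) z = symp x z + symp y z := by
  simp [symp, scalar, add_dotProduct]

theorem symp_add_right {n : ℕ} (x y z : Fin n → ℂ) :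
    symp x (y + z) = symp x y + symp x z := by
  simp [symp, scalar, star_add, dotProduct_add]

theorem symp_neg_left {n : ℕ} (x y : Fin n → ℂ) : symp (-x) y = -symp x y := by
  simp [symp, scalar]

theorem symp_smul_left {n : ℕ} (c : ℝ) (x y : Fin n → ℂ) :
    symp ((c : ℂ) • x) y = c * symp x y := by
  simp [symp, scalar]

theorem symp_swap {n : ℕ} (x y : Fin n → ℂ) : symp x y = -symp y x := by
  have h : scalar x y = star (scalar y x) := by
    simp [scalar, dotProduct, mul_comm]
  simp [symp, h]

theorem symp_self {n : ℕ} (x : Fin n → ℂ) : symp x x = 0 := by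
  have := symp_swap x x
  linarith

theorem scalar_mulVec_left {n : ℕ} (M : Matrix (Fin n) (Fin n) ℂ) (x y : Fin n → ℂ) :
    scalar (M *ᵥ x) y = scalar x (Mᴴ *ᵥ y) := by
  simp only [scalar]
  rw [star_mulVec, conjTranspose_conjTranspose, dotProduct_comm, dotProduct_mulVec,
    dotProduct_comm]

theorem symp_mulVec_left {n : ℕ} (M : Matrix (Fin n) (Fin n) ℂ) (x y : Fin n → ℂ) :
    symp (M *ᵥ x) y = symp x (Mᴴ *ᵥ y) := by
  simp [symp, scalar_mulVec_left]

theorem unitary_conj_mul {n : ℕ} (A : unitaryGroup (Fin n) ℂ) :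
    (A : Matrix (Fin n) (Fin n) ℂ)ᴴ * (A : Matrix (Fin n) (Fin n) ℂ) = 1 := by
  have := A.2
  rw [mem_unitaryGroup_iff'] at this
  simpa [star_eq_conjTranspose] using this

theorem symp_unitary {n : ℕ} (A : unitaryGroup (Fin n) ℂ) (x y : Fin n → ℂ) :
    symp ((A : Matrix (Fin n) (Fin n) ℂ) *ᵥ x) ((A : Matrix (Fin n) (Fin n) ℂ) *ᵥ y)
      = symp x y := by
  rw [symp_mulVec_left, mulVec_mulVec, unitary_conj_mul, one_mulVec]

/-- The underlying set of the group `G_n = U(n) ⋉ ℍ_n`, with `ℍ_n = ℂⁿ × ℝ`. -/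
@[ext] structure G (n : ℕ) where
  /-- the component in `U(n)` -/
  A : unitaryGroup (Fin n) ℂ
  /-- the component in `ℂⁿ` -/
  z : Fin n → ℂ
  /-- the central component -/
  t : ℝ

/-- The matrix of the `U(n)`-component. -/
abbrev G.mat {n : ℕ} (g : G n) : Matrix (Fin n) (Fin n) ℂ := (g.A : Matrix (Fin n) (Fin n) ℂ)

instance (n : ℕ) : Mul (G n) :=
  ⟨fun g h => ⟨g.A * h.A, g.z + g.mat *ᵥ h.z, g.t + h.t - symp g.z (g.mat *ᵥ h.z) / 2⟩⟩

instance (n : ℕ) : One (G n) := ⟨⟨1, 0, 0⟩⟩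

instance (n : ℕ) : Inv (G n) :=
  ⟨fun g => ⟨g.A⁻¹, -(((g.A⁻¹ : unitaryGroup (Fin n) ℂ) : Matrix (Fin n) (Fin n) ℂ) *ᵥ g.z), -g.t⟩⟩

@[simp] theorem mul_A {n : ℕ} (g h : G n) : (g * h).A = g.A * h.A := rfl
@[simp] theorem mul_z {n : ℕ} (g h : G n) : (g * h).z = g.z + g.mat *ᵥ h.z := rfl
@[simp] theorem mul_t {n : ℕ} (g h : G n) :
    (g * h).t = g.t + h.t - symp g.z (g.mat *ᵥ h.z) / 2 := rfl
@[simp] theorem one_A {n : ℕ} : (1 : G n).A = 1 := rfl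
@[simp] theorem one_z {n : ℕ} : (1 : G n).z = 0 := rfl
@[simp] theorem one_t {n : ℕ} : (1 : G n).t = 0 := rfl
@[simp] theorem inv_A {n : ℕ} (g : G n) : (g⁻¹).A = (g.A)⁻¹ := rfl
@[simp] theorem inv_z {n : ℕ} (g : G n) :
    (g⁻¹).z = -(((g.A⁻¹ : unitaryGroup (Fin n) ℂ) : Matrix (Fin n) (Fin n) ℂ) *ᵥ g.z) := rfl
@[simp] theorem inv_t {n : ℕ} (g : G n) : (g⁻¹).t = -g.t := rfl

instance (n : ℕ) : Group (G n) :=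
  Group.ofLeftAxioms
    (by
      intro a b c
      ext1
      · simp [mul_assoc]
      · simp [mulVec_add, mulVec_mulVec, add_assoc, G.mat]
      · simp only [mul_t, mul_A, mul_z, mulVec_add, symp_add_right, symp_add_left,
          G.mat, UnitaryGroup.mul_val]
        rw [← mulVec_mulVec, symp_unitary]
        ring)
    (by
      intro a
      ext1
      · simp
      · simp [G.mat]
      · simp [symp, scalar])
    (by
      intro a
      ext1
      · simp
      · simp [G.mat]
      · simp [G.mat, symp_neg_left, symp_self])

/-- The Lie algebra `𝔲(n)` of skew-Hermitian matrices (a real vector space). -/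
abbrev LieU (n : ℕ) : Submodule ℝ (Matrix (Fin n) (Fin n) ℂ) :=
  skewAdjoint.submodule ℝ (Matrix (Fin n) (Fin n) ℂ)

theorem mem_LieU {n : ℕ} {M : Matrix (Fin n) (Fin n) ℂ} : M ∈ LieU n ↔ Mᴴ = -M := Iff.rfl

/-- The matrix `z × w = (i/2) (w z* + z w*)`. -/
def cross {n : ℕ} (z w : Fin n → ℂ) : Matrix (Fin n) (Fin n) ℂ :=
  (Complex.I / 2) • (vecMulVec w (star z) + vecMulVec z (star w))

theorem cross_mem {n : ℕ} (z w : Fin n → ℂ) : cross z w ∈ LieU n := by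
  rw [mem_LieU]
  simp only [cross, conjTranspose_smul, conjTranspose_add, conjTranspose_vecMulVec, star_star]
  rw [add_comm, ← neg_smul]
  congr 1
  simp [neg_div]

theorem cross_comm {n : ℕ} (z w : Fin n → ℂ) : cross z w = cross w z := by
  simp [cross, add_comm]

theorem cross_add_left {n : ℕ} (x y w : Fin n → ℂ) : cross (x + y) w = cross x w + cross y w := by
  simp only [cross, star_add, vecMulVec_add, add_vecMulVec, ← smul_add]
  congr 1
  abel

theorem cross_add_right {n : ℕ} (x y w : Fin n → ℂ) :
    cross w (x + y) = cross w x + cross w y := by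
  rw [cross_comm, cross_add_left, cross_comm x, cross_comm y]

theorem cross_smul_right {n : ℕ} (c : ℝ) (x w : Fin n → ℂ) :
    cross w ((c : ℂ) • x) = c • cross w x := by
  ext i j
  simp [cross, vecMulVec_apply]
  ring

theorem conj_cross {n : ℕ} (M : Matrix (Fin n) (Fin n) ℂ) (z w : Fin n → ℂ) :
    M * cross z w * Mᴴ = cross (M *ᵥ z) (M *ᵥ w) := by
  simp only [cross, Matrix.mul_smul, Matrix.smul_mul, mul_add, add_mul, mul_vecMulVec,
    vecMulVec_mul, star_mulVec]

theorem conj_mem {n : ℕ} (M : Matrix (Fin n) (Fin n) ℂ) (U : LieU n) :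
    M * (U : Matrix (Fin n) (Fin n) ℂ) * Mᴴ ∈ LieU n := by
  have h := mem_LieU.1 U.2
  rw [mem_LieU]
  simp [conjTranspose_mul, h, mul_assoc]

/-- The real vector space underlying the Lie algebra `𝔤_n = 𝔲(n) ⋉ 𝔥_n`, with `𝔥_n = ℂⁿ × ℝ`. -/
abbrev LieG (n : ℕ) : Type := LieU n × (Fin n → ℂ) × ℝ

/-- The adjoint action of `G_n` on `𝔤_n`:
`Ad(A,z,t)(B,w,s) = (ABA*, -ABA*z + Aw, s - ω(z,Aw) + ω(A*z, BA*z)/2)`. -/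
def Ad {n : ℕ} (g : G n) (X : LieG n) : LieG n :=
  (⟨g.mat * X.1.1 * g.matᴴ, conj_mem g.mat X.1⟩,
    -((g.mat * X.1.1 * g.matᴴ) *ᵥ g.z) + g.mat *ᵥ X.2.1,
    X.2.2 - symp g.z (g.mat *ᵥ X.2.1) + symp (g.matᴴ *ᵥ g.z) (X.1.1 *ᵥ (g.matᴴ *ᵥ g.z)) / 2)

/-- The dual `𝔤_n*`, realised as the space of triples `(U, u, x)` in `𝔲(n) × ℂⁿ × ℝ` (with its
usual topology); the triple stands for the linear form `pairing (U, u, x)` below. -/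
abbrev LieGDual (n : ℕ) : Type := LieU n × (Fin n → ℂ) × ℝ

/-- The duality `⟨(U,u,x), (B,w,s)⟩ = tr(UB) + ω(u,w) + xs`; the trace `tr(UB)` is real
for skew-Hermitian `U` and `B`. -/
def pairing {n : ℕ} (l : LieGDual n) (X : LieG n) : ℝ :=
  (trace (l.1.1 * X.1.1)).re + symp l.2.1 X.2.1 + l.2.2 * X.2.2

/-- The coadjoint action of `G_n` on `𝔤_n*`:
`Ad*(A,z,t)(U,u,x) = (AUA* + z × (Au) + (x/2) z × z, Au + xz, x)`. -/
instance (n : ℕ) : SMul (G n) (LieGDual n) :=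
  ⟨fun g l =>
    (⟨g.mat * l.1.1 * g.matᴴ + cross g.z (g.mat *ᵥ l.2.1) + (l.2.2 / 2) • cross g.z g.z,
        (LieU n).add_mem ((LieU n).add_mem (conj_mem g.mat l.1) (cross_mem _ _))
          ((LieU n).smul_mem _ (cross_mem _ _))⟩,
      g.mat *ᵥ l.2.1 + (l.2.2 : ℂ) • g.z, l.2.2)⟩

theorem smul_fst {n : ℕ} (g : G n) (l : LieGDual n) :
    ((g • l).1 : Matrix (Fin n) (Fin n) ℂ)
      = g.mat * l.1.1 * g.matᴴ + cross g.z (g.mat *ᵥ l.2.1) + (l.2.2 / 2) • cross g.z g.z := rfl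

theorem smul_snd {n : ℕ} (g : G n) (l : LieGDual n) :
    (g • l).2.1 = g.mat *ᵥ l.2.1 + (l.2.2 : ℂ) • g.z := rfl

theorem smul_trd {n : ℕ} (g : G n) (l : LieGDual n) : (g • l).2.2 = l.2.2 := rfl

instance (n : ℕ) : MulAction (G n) (LieGDual n) where
  one_smul l := by
    refine Prod.ext (Subtype.ext ?_) (Prod.ext ?_ rfl)
    · rw [smul_fst]
      simp [G.mat, cross]
    · rw [smul_snd]
      simp [G.mat]
  mul_smul g h l := by
    refine Prod.ext (Subtype.ext ?_) (Prod.ext ?_ rfl)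
    · simp only [smul_fst, smul_snd, smul_trd, mul_z, mul_A, G.mat, UnitaryGroup.mul_val,
        mul_add, add_mul, Matrix.mul_smul, Matrix.smul_mul, mulVec_add, mulVec_smul,
        cross_add_left, cross_add_right, cross_smul_right, conjTranspose_mul, mul_assoc,
        ← mulVec_mulVec]
      rw [cross_comm ((g.A : Matrix (Fin n) (Fin n) ℂ) *ᵥ h.z) g.z]
      simp only [← mul_assoc, conj_cross]
      module
    · simp only [smul_snd, smul_trd, mul_z, mul_A, G.mat, UnitaryGroup.mul_val, mulVec_add,
        mulVec_smul, ← mulVec_mulVec]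
      module

theorem trace_cross {n : ℕ} (z w : Fin n → ℂ) (B : LieU n) :
    (trace (cross z w * B.1)).re = symp w (B.1 *ᵥ z) := by
  have hB := mem_LieU.1 B.2
  have h1 : trace (vecMulVec w (star z) * B.1) = scalar (B.1 *ᵥ w) z := by
    rw [trace_mul_comm, mul_vecMulVec, trace_vecMulVec, scalar]
  have h2 : trace (vecMulVec z (star w) * B.1) = scalar (B.1 *ᵥ z) w := by
    rw [trace_mul_comm, mul_vecMulVec, trace_vecMulVec, scalar]
  have h3 : symp (B.1 *ᵥ w) z = - symp w (B.1 *ᵥ z) := by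
    rw [symp_mulVec_left, hB, neg_mulVec, symp_swap, symp_neg_left, symp_swap w]
  have h4 : symp (B.1 *ᵥ z) w = - symp w (B.1 *ᵥ z) := symp_swap _ _
  rw [cross, Matrix.smul_mul, add_mul, trace_smul, trace_add, h1, h2]
  simp only [symp] at h3 h4 ⊢
  simp [h3, h4]
  ring

/-- The action above is the coadjoint action: `⟨Ad*(g) l, X⟩ = ⟨l, Ad(g⁻¹) X⟩`. -/
theorem pairing_smul {n : ℕ} (g : G n) (l : LieGDual n) (X : LieG n) :
    pairing (g • l) X = pairing l (Ad g⁻¹ X) := by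
  have hm : (g⁻¹).mat = g.matᴴ := by
    simp [G.mat, UnitaryGroup.inv_val, star_eq_conjTranspose]
  have hu : g.mat * g.matᴴ = 1 := by
    have := mem_unitaryGroup_iff.1 g.A.2
    simpa [star_eq_conjTranspose] using this
  have hz : (g⁻¹).z = -(g.matᴴ *ᵥ g.z) := by
    rw [inv_z]
    simp [G.mat, UnitaryGroup.inv_val, star_eq_conjTranspose]
  have hzz : g.mat *ᵥ (g⁻¹).z = -g.z := by
    rw [hz, mulVec_neg, mulVec_mulVec, hu, one_mulVec]
  have ht : trace (g.mat * l.1.1 * g.matᴴ * X.1.1)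
      = trace (l.1.1 * (g.matᴴ * X.1.1 * g.mat)) := by
    rw [mul_assoc, mul_assoc, trace_mul_comm]
    simp only [mul_assoc]
  have h1 : symp (g.mat *ᵥ l.2.1) (X.1.1 *ᵥ g.z)
      = symp l.2.1 (-((g.matᴴ * X.1.1 * g.mat) *ᵥ (g⁻¹).z)) := by
    rw [← mulVec_mulVec, hzz, symp_mulVec_left, mulVec_neg, neg_neg, mulVec_mulVec]
  have h2 : symp (g⁻¹).z (g.matᴴ *ᵥ X.2.1) = -symp g.z X.2.1 := by
    rw [← symp_mulVec_left, hzz, symp_neg_left]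
  have h3 : symp (-g.z) (X.1.1 *ᵥ -g.z) = symp g.z (X.1.1 *ᵥ g.z) := by
    rw [mulVec_neg, symp_neg_left, symp_swap, symp_neg_left, symp_swap (X.1.1 *ᵥ g.z)]
    ring
  have h4 : symp (g.mat *ᵥ l.2.1) X.2.1 = symp l.2.1 (g.matᴴ *ᵥ X.2.1) :=
    symp_mulVec_left _ _ _
  have hs : (trace ((l.2.2 / 2) • cross g.z g.z * X.1.1)).re
      = l.2.2 / 2 * symp g.z (X.1.1 *ᵥ g.z) := by
    rw [← trace_cross, Matrix.smul_mul, trace_smul, Complex.smul_re, smul_eq_mul]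
  simp only [pairing, Ad, smul_fst, smul_snd, smul_trd, hm, conjTranspose_conjTranspose, hzz,
    add_mul, trace_add, Complex.add_re, trace_cross, hs, ht, symp_add_left, symp_smul_left,
    symp_add_right, h1, h2, h3, h4]
  ring

/-- The dominant integral forms `P_n` for `U(n)`: integer tuples `λ_1 ≥ ⋯ ≥ λ_n`. -/
abbrev Weight (n : ℕ) : Type := {l : Fin n → ℤ // Antitone l}

theorem diagonal_mem {n : ℕ} (d : Fin n → ℝ) :
    diagonal (fun j => Complex.I * (d j : ℂ)) ∈ LieU n := by
  rw [mem_LieU, diagonal_conjTranspose, diagonal_neg]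
  congr 1
  ext j
  simp

/-- The matrix `diag(i d_1, …, i d_n)`. -/
def J {n : ℕ} (d : Fin n → ℝ) : LieU n := ⟨diagonal (fun j => Complex.I * (d j : ℂ)), diagonal_mem d⟩

/-- The linear form `ℓ_{λ,α} = (J_λ, 0, α)`. -/
def ellGen {n : ℕ} (l : Weight n) (a : ℝ) : LieGDual n := (J (fun j => (l.1 j : ℝ)), 0, a)

/-- The linear form `ℓ_{μ,r} = (J_μ, v_r, 0)`, where `n = m + 1`, `μ ∈ P_{n-1}`,
`J_μ = diag(i μ_1, …, i μ_{n-1}, 0)` and `v_r = (0, …, 0, r)`. -/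
def ellMid {m : ℕ} (mu : Weight m) (r : ℝ) : LieGDual (m + 1) :=
  (J (Fin.snoc (α := fun _ => ℝ) (fun j => (mu.1 j : ℝ)) 0), Pi.single (Fin.last m) (r : ℂ), 0)

/-- The linear form `ℓ_λ = (J_λ, 0, 0)`. -/
def ellU {n : ℕ} (l : Weight n) : LieGDual n := (J (fun j => (l.1 j : ℝ)), 0, 0)

/-- The set `𝔤_n^‡` (here `n = m + 1`): the union of the coadjoint orbits of the linear forms
`ℓ_{λ,α}` (`α ≠ 0`), `ℓ_{μ,r}` (`r > 0`) and `ℓ_λ`. It is a `G_n`-stable subset of `𝔤_n*`. -/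
def admissible (m : ℕ) : SubMulAction (G (m + 1)) (LieGDual (m + 1)) where
  carrier :=
    (⋃ (l : Weight (m + 1)) (a : {a : ℝ // a ≠ 0}), MulAction.orbit (G (m + 1)) (ellGen l a.1)) ∪
    (⋃ (mu : Weight m) (r : {r : ℝ // 0 < r}), MulAction.orbit (G (m + 1)) (ellMid mu r.1)) ∪
    (⋃ l : Weight (m + 1), MulAction.orbit (G (m + 1)) (ellU l))
  smul_mem' := by
    intro g x hx
    simp only [Set.mem_union, Set.mem_iUnion] at hx ⊢
    rcases hx with (⟨l, a, h⟩ | ⟨mu, r, h⟩) | ⟨l, h⟩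
    · exact Or.inl (Or.inl ⟨l, a, (MulAction.mem_orbit_of_mem_orbit g h)⟩)
    · exact Or.inl (Or.inr ⟨mu, r, (MulAction.mem_orbit_of_mem_orbit g h)⟩)
    · exact Or.inr ⟨l, (MulAction.mem_orbit_of_mem_orbit g h)⟩

/-- The orbit space `𝔤_n^‡ / G_n` (with `n = m + 1`), carrying the quotient topology of the
subspace topology of `𝔤_n^‡ ⊆ 𝔤_n*`. -/
abbrev OrbitSpace (m : ℕ) : Type := Quotient (MulAction.orbitRel (G (m + 1)) (admissible m))

theorem ellGen_mem {m : ℕ} (l : Weight (m + 1)) (a : {a : ℝ // a ≠ 0}) :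
    ellGen l a.1 ∈ admissible m :=
  Or.inl (Or.inl (Set.mem_iUnion₂.2 ⟨l, a, MulAction.mem_orbit_self _⟩))

theorem ellMid_mem {m : ℕ} (mu : Weight m) (r : {r : ℝ // 0 < r}) :
    ellMid mu r.1 ∈ admissible m :=
  Or.inl (Or.inr (Set.mem_iUnion₂.2 ⟨mu, r, MulAction.mem_orbit_self _⟩))

theorem ellU_mem {m : ℕ} (l : Weight (m + 1)) : ellU l ∈ admissible m :=
  Or.inr (Set.mem_iUnion.2 ⟨l, MulAction.mem_orbit_self _⟩)

/-- The orbit `O_{(λ,α)}` as a point of the orbit space. -/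
def orbGen {m : ℕ} (l : Weight (m + 1)) (a : {a : ℝ // a ≠ 0}) : OrbitSpace m :=
  Quotient.mk _ ⟨ellGen l a.1, ellGen_mem l a⟩

/-- The orbit `O_{(μ,r)}` as a point of the orbit space. -/
def orbMid {m : ℕ} (mu : Weight m) (r : {r : ℝ // 0 < r}) : OrbitSpace m :=
  Quotient.mk _ ⟨ellMid mu r.1, ellMid_mem mu r⟩

/-- The orbit `O_λ` as a point of the orbit space. -/
def orbU {m : ℕ} (l : Weight (m + 1)) : OrbitSpace m :=
  Quotient.mk _ ⟨ellU l, ellU_mem l⟩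

/-- `a_1 ≥ b_1 ≥ a_2 ≥ b_2 ≥ ⋯ ≥ a_n ≥ b_n`, with `n = m + 1`. -/
def Interlace {m : ℕ} (a b : Weight (m + 1)) : Prop :=
  (∀ j : Fin (m + 1), b.1 j ≤ a.1 j) ∧ ∀ j : Fin m, a.1 j.succ ≤ b.1 j.castSucc

/-- `a_1 ≥ b_1 ≥ a_2 ≥ b_2 ≥ ⋯ ≥ a_{n-1} ≥ b_{n-1} ≥ a_n`, with `n = m + 1`. -/
def InterlaceShort {m : ℕ} (a : Weight (m + 1)) (b : Weight m) : Prop :=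
  ∀ j : Fin m, b.1 j ≤ a.1 j.castSucc ∧ a.1 j.succ ≤ b.1 j

end HeisenbergMotion

end

open Filter Topology Matrix

noncomputable section

namespace HeisenbergMotion

/-! ### Convergence in the orbit space -/

section Topology

variable {n : ℕ}

/-! The orbit map is open, so orbits converge to the orbit of `y` exactly when they eventually meet
every neighbourhood of `y`. Continuous invariants therefore pass to the limit, and explicit
convergent representatives give the converse.

Write `U = iH`. Besides `x`, the main invariant is the polynomial `detInv`, minus the determinant of
`t - H` bordered by `u`, `u*` and the corner `-2x`; the group acts on the bordered matrix by
congruence. It equals `2α ∏ (t - λ_i)` on the orbit of `(λ,α)`, `r² ∏ (t - μ_j)` on that of `(μ,r)`,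
and vanishes on that of `λ`. By the normal forms it determines the orbit once `x` is fixed and
either `x ≠ 0` or the polynomial is nonzero (`mem_orbit_ellGen`, `mem_orbit_ellMid`). When it has a
nonzero limit, integrality of the roots makes the roots of the limit eventually roots along the
sequence (`eventually_le_of_tendsto`). This settles the limits `(λ,α)` and `(μ,r)`; in the passage
from `(λ^k,α_k)` to `(μ,r)` one root `s_k` escapes, with `α_k s_k → -r²/2`.

For the limit `λ` the polynomial says nothing. Instead, some representative has `H` close to
`diag(λ)`. Up to conjugation its `H` is `diag(λ^k)` plus a rank one term of the sign of `α_k`, or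
has compression `diag(μ^k)` to a hyperplane. Min-max with integral spectra then gives interlacing.
Conversely, on `(J_λ, u, x)` the invariant is `2x ∏ (t - λ_i) + ∑ |u_i|² ∏_{j≠i} (t - λ_j)`.
Interlacing says precisely that the weights `|u_i|²` needed to reach the prescribed polynomial are
nonnegative (`exists_weights`, `exists_weights_compression`), and the second invariant `traceInv`
shows that `u → 0`. -/

theorem continuous_coe_fst :
    Continuous fun l : LieGDual n => (l.1 : Matrix (Fin n) (Fin n) ℂ) :=
  continuous_subtype_val.comp continuous_fst

theorem continuous_cross_right (z : Fin n → ℂ) : Continuous fun w : Fin n → ℂ => cross z w := by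
  unfold cross
  refine continuous_matrix fun i j => ?_
  simp only [Matrix.smul_apply, Matrix.add_apply, vecMulVec_apply, Pi.star_apply]
  fun_prop

instance : ContinuousConstSMul (G n) (LieGDual n) where
  continuous_const_smul g := by
    have hU := continuous_coe_fst (n := n)
    have hu : Continuous fun l : LieGDual n => g.mat *ᵥ l.2.1 :=
      Continuous.matrix_mulVec continuous_const (continuous_fst.comp continuous_snd)
    have hx : Continuous fun l : LieGDual n => l.2.2 := continuous_snd.comp continuous_snd
    refine Continuous.prodMk (Continuous.subtype_mk ?_ _) (Continuous.prodMk ?_ hx)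
    · refine Continuous.add (Continuous.add ?_ ((continuous_cross_right g.z).comp hu)) ?_
      · exact (continuous_const.matrix_mul hU).matrix_mul continuous_const
      · exact (hx.div_const 2).smul continuous_const
    · exact hu.add ((Complex.continuous_ofReal.comp hx).smul continuous_const)

instance (m : ℕ) : ContinuousConstSMul (G (m + 1)) (admissible m) where
  continuous_const_smul g :=
    Continuous.subtype_mk ((continuous_const_smul g).comp continuous_subtype_val) _

/-- Convergence in the orbit space, in terms of the orbits. -/
theorem tendsto_orbit_iff {m : ℕ} (x : ℕ → admissible m) (y : admissible m) :
    Tendsto (fun k => (Quotient.mk _ (x k) : OrbitSpace m)) atTop (𝓝 (Quotient.mk _ y)) ↔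
      ∀ V ∈ 𝓝 (y : LieGDual (m + 1)), ∀ᶠ k in atTop,
        ∃ g : G (m + 1), g • (x k : LieGDual (m + 1)) ∈ V := by
  constructor
  · intro h V hV
    have hW : Subtype.val ⁻¹' V ∈ 𝓝 y := continuous_subtype_val.continuousAt hV
    -- The quotient map of an action by homeomorphisms is open.
    have himg := (isOpenMap_quotient_mk'_mul (Γ := G (m + 1)) (T := admissible m)).image_mem_nhds hW
    filter_upwards [h himg] with k hk
    obtain ⟨w, hw, hwk⟩ := hk
    obtain ⟨g, hg⟩ := MulAction.orbitRel_apply.1 (Quotient.exact hwk)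
    refine ⟨g, ?_⟩
    have : g • (x k : LieGDual (m + 1)) = w := congrArg Subtype.val hg
    rw [this]
    exact hw
  · intro h W hW
    have hpre : (fun w : admissible m => (Quotient.mk _ w : OrbitSpace m)) ⁻¹' W ∈ 𝓝 y :=
      continuous_quotient_mk'.continuousAt hW
    obtain ⟨V, hV, hVW⟩ := mem_nhds_subtype _ _ _ |>.1 hpre
    have hVk := h V hV
    rw [mem_map]
    filter_upwards [hVk] with k hk
    obtain ⟨g, hg⟩ := hk
    have h1 : g • x k ∈ (fun w : admissible m => (Quotient.mk _ w : OrbitSpace m)) ⁻¹' W :=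
      hVW hg
    have h2 : (Quotient.mk _ (x k) : OrbitSpace m) = Quotient.mk _ (g • x k) :=
      Quotient.sound (MulAction.orbitRel_apply.2 ⟨g⁻¹, by simp⟩)
    change (Quotient.mk _ (x k) : OrbitSpace m) ∈ W
    rw [h2]
    exact h1

theorem tendsto_orbit_of_tendsto {m : ℕ} {x : ℕ → admissible m} {y : admissible m}
    (w : ℕ → LieGDual (m + 1))
    (hw : ∀ᶠ k in atTop, w k ∈ MulAction.orbit (G (m + 1)) (x k : LieGDual (m + 1)))
    (h : Tendsto w atTop (𝓝 (y : LieGDual (m + 1)))) :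
    Tendsto (fun k => (Quotient.mk _ (x k) : OrbitSpace m)) atTop (𝓝 (Quotient.mk _ y)) := by
  rw [tendsto_orbit_iff]
  intro V hV
  filter_upwards [hw, h hV] with k hk hkV
  obtain ⟨g, hg⟩ := hk
  exact ⟨g, by simpa [hg] using hkV⟩

/-- A continuous invariant function is continuous on the orbit space. -/
theorem tendsto_invariant {m : ℕ} {X : Type*} [TopologicalSpace X] {f : LieGDual (m + 1) → X}
    (hf : Continuous f) (hinv : ∀ (g : G (m + 1)) l, f (g • l) = f l)
    {x : ℕ → admissible m} {y : admissible m}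
    (h : Tendsto (fun k => (Quotient.mk _ (x k) : OrbitSpace m)) atTop (𝓝 (Quotient.mk _ y))) :
    Tendsto (fun k => f (x k)) atTop (𝓝 (f y)) := by
  intro V hV
  rw [tendsto_orbit_iff] at h
  have hk := h _ (hf.continuousAt hV)
  rw [mem_map]
  filter_upwards [hk] with k ⟨g, hg⟩
  simpa [hinv] using hg

end Topology

/-! ### Two continuous invariants of the coadjoint action -/

section Invariants

variable {n : ℕ}

/-- The bordered matrix `[[t - H, u], [u*, -2x]]`, where `U = iH`. -/
def bordered (t : ℝ) (l : LieGDual n) : Matrix (Fin n ⊕ Unit) (Fin n ⊕ Unit) ℂ :=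
  fromBlocks ((t : ℂ) • 1 + Complex.I • l.1.1) (replicateCol Unit l.2.1)
    (replicateRow Unit (star l.2.1)) (of fun _ _ => ((-2 * l.2.2 : ℝ) : ℂ))

/-- The determinant `-det [[t - H, u], [u*, -2x]]`. -/
def detInv (t : ℝ) (l : LieGDual n) : ℂ := -(bordered t l).det

theorem mat_mul_conj (g : G n) : g.mat * g.matᴴ = 1 := by
  simpa [star_eq_conjTranspose] using mem_unitaryGroup_iff.1 g.A.2

/-- The corner `-2x` is chosen so that translation by `z` becomes a block operation with column
`-z/2`: it adds `xz` to the border and `-(x/2) zz*` to the main block. The congruence matrix has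
determinant of modulus one, so the determinant is invariant. -/
theorem bordered_smul (t : ℝ) (g : G n) (l : LieGDual n) :
    bordered t (g • l) =
      fromBlocks g.mat (replicateCol Unit ((-(1 / 2) : ℂ) • g.z)) 0 1 * bordered t l *
        (fromBlocks g.mat (replicateCol Unit ((-(1 / 2) : ℂ) • g.z)) 0 1)ᴴ := by
  have hu := mat_mul_conj g
  have hI := Complex.I_mul_I
  rw [bordered, bordered, fromBlocks_conjTranspose, fromBlocks_multiply, fromBlocks_multiply,
    smul_fst, smul_snd, smul_trd]
  congr 1
  · simp only [mul_add, add_mul, Matrix.mul_smul, Matrix.smul_mul, mul_one, hu]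
    ext i j
    have h1 : ∀ a : Fin n, (g.mat *ᵥ l.2.1) a = ∑ b, g.mat a b * l.2.1 b := fun a => rfl
    have h2 : ∑ x, (starRingEnd ℂ) (g.mat j x) * (starRingEnd ℂ) (l.2.1 x) =
        ∑ x, (starRingEnd ℂ) (l.2.1 x) * (starRingEnd ℂ) (g.mat j x) :=
      Finset.sum_congr rfl fun _ _ => mul_comm _ _
    simp only [cross, Matrix.add_apply, Matrix.smul_apply, smul_eq_mul, vecMulVec_apply,
      Pi.star_apply, conjTranspose_replicateCol, Matrix.mul_apply, replicateCol_apply,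
      replicateRow_apply, Finset.univ_unique, Finset.sum_singleton, of_apply, Pi.smul_apply,
      star_smul, h1, conjTranspose_apply, Complex.real_smul]
    simp only [← Finset.mul_sum, mul_assoc]
    push_cast
    simp
    rw [h2]
    linear_combination ((∑ b, g.mat i b * l.2.1 b) * (starRingEnd ℂ) (g.z j) * (1 / 2) +
      (starRingEnd ℂ) (g.z j) * g.z i * l.2.2 * (1 / 2) +
      (g.z i * ∑ x, (starRingEnd ℂ) (l.2.1 x) * (starRingEnd ℂ) (g.mat j x)) * (1 / 2)) * hI
  · ext i j
    simp [Matrix.mul_apply, mulVec, dotProduct]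
    ring
  · ext i j
    simp [Matrix.mul_apply, mulVec, dotProduct, mul_comm]
    ring
  · simp

theorem detInv_smul (t : ℝ) (g : G n) (l : LieGDual n) : detInv t (g • l) = detInv t l := by
  have h := congrArg det (mat_mul_conj g)
  rw [det_mul, det_one] at h
  rw [detInv, detInv, bordered_smul, det_mul, det_mul, fromBlocks_conjTranspose,
    det_fromBlocks_zero₂₁, conjTranspose_zero, det_fromBlocks_zero₁₂]
  simp only [conjTranspose_one, det_one, mul_one]
  linear_combination (-(bordered t l).det) * h

theorem continuous_detInv (t : ℝ) : Continuous (detInv (n := n) t) := by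
  have hU := continuous_coe_fst (n := n)
  have hu : Continuous fun l : LieGDual n => l.2.1 := continuous_fst.comp continuous_snd
  have hx : Continuous fun l : LieGDual n => l.2.2 := continuous_snd.comp continuous_snd
  refine (Continuous.matrix_det (Continuous.matrix_fromBlocks ?_ ?_ ?_ ?_)).neg
  · refine continuous_const.add (continuous_matrix fun i j => ?_)
    exact continuous_const.mul (hU.matrix_elem i j)
  · exact continuous_matrix fun i j => (continuous_apply i).comp hu
  · exact continuous_matrix fun i j => continuous_star.comp ((continuous_apply j).comp hu)
  · exact continuous_matrix fun i j => Complex.continuous_ofReal.comp (continuous_const.mul hx)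

/-- Schur complement with respect to the invertible diagonal block. -/
theorem det_arrowhead_of_ne_zero (d u v : Fin n → ℂ) (s : ℂ) (hd : ∀ i, d i ≠ 0) :
    (fromBlocks (diagonal d) (replicateCol Unit u) (replicateRow Unit v) (of fun _ _ => s)).det
      = s * ∏ i, d i - ∑ i, v i * u i * ∏ j ∈ Finset.univ.erase i, d j := by
  let : Invertible (diagonal d) := by
    refine invertibleOfRightInverse _ (diagonal fun i => (d i)⁻¹) ?_
    rw [diagonal_mul_diagonal, ← diagonal_one]
    congr 1
    ext i
    exact mul_inv_cancel₀ (hd i)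
  have hinv : ⅟(diagonal d) = diagonal fun i => (d i)⁻¹ := rfl
  rw [det_fromBlocks₁₁, hinv, det_diagonal, det_unique]
  simp only [Matrix.sub_apply, of_apply, Matrix.mul_apply, replicateRow_apply,
    replicateCol_apply, mul_sub, Finset.mul_sum]
  rw [mul_comm]
  congr 1
  refine Finset.sum_congr rfl fun i _ => ?_
  have : ∑ x, v x * diagonal (fun i => (d i)⁻¹) x i = v i * (d i)⁻¹ := by
    rw [Finset.sum_eq_single i] <;> simp +contextual
  rw [← Finset.mul_prod_erase _ _ (Finset.mem_univ i), this]
  field_simp [hd i]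

/-- Both sides are continuous in a shift `d + e`, and every small `e ≠ 0` makes all diagonal entries
nonzero. -/
theorem det_arrowhead (d u v : Fin n → ℂ) (s : ℂ) :
    (fromBlocks (diagonal d) (replicateCol Unit u) (replicateRow Unit v) (of fun _ _ => s)).det
      = s * ∏ i, d i - ∑ i, v i * u i * ∏ j ∈ Finset.univ.erase i, d j := by
  have hev : ∀ᶠ e : ℂ in 𝓝[≠] 0, ∀ i, d i + e ≠ 0 := by
    rw [eventually_all]
    intro i
    by_cases h : d i = 0
    · filter_upwards [self_mem_nhdsWithin] with e he
      simpa [h] using he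
    · have hc : Continuous fun e : ℂ => d i + e := by fun_prop
      exact nhdsWithin_le_nhds (hc.continuousAt.eventually_ne (by simpa using h))
  have hc1 : Continuous fun e : ℂ => (fromBlocks (diagonal fun i => d i + e) (replicateCol Unit u)
      (replicateRow Unit v) (of fun _ _ => s)).det := by
    refine Continuous.matrix_det (Continuous.matrix_fromBlocks ?_ continuous_const
      continuous_const continuous_const)
    exact Continuous.matrix_diagonal (by fun_prop)
  have hc2 : Continuous fun e : ℂ => s * ∏ i, (d i + e) -
      ∑ i, v i * u i * ∏ j ∈ Finset.univ.erase i, (d j + e) := by fun_prop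
  have h1 := (hc1.tendsto 0).mono_left (nhdsWithin_le_nhds (s := {0}ᶜ))
  have h2 := (hc2.tendsto 0).mono_left (nhdsWithin_le_nhds (s := {0}ᶜ))
  have := tendsto_nhds_unique_of_eventuallyEq h1 h2
    (hev.mono fun e he => det_arrowhead_of_ne_zero _ u v s he)
  simpa using this

theorem detInv_diagonal (t : ℝ) (d : Fin n → ℝ) (u : Fin n → ℂ) (x : ℝ) :
    detInv t (J d, u, x) = ((2 * x * ∏ i, (t - d i) +
      ∑ i, ‖u i‖ ^ 2 * ∏ j ∈ Finset.univ.erase i, (t - d j) : ℝ) : ℂ) := by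
  have h : (t : ℂ) • (1 : Matrix (Fin n) (Fin n) ℂ) + Complex.I • (J d).1 =
      diagonal fun i => ((t - d i : ℝ) : ℂ) := by
    ext i j
    by_cases hij : i = j
    · subst hij
      simp [J, ← mul_assoc, sub_eq_add_neg]
    · simp [J, hij]
  rw [detInv, bordered, h, det_arrowhead]
  have h2 : ∀ i, (star u) i * u i = ((‖u i‖ ^ 2 : ℝ) : ℂ) := fun i => by
    simp [Complex.conj_mul']
  simp only [h2]
  push_cast
  ring

theorem detInv_snoc_single {m : ℕ} (t : ℝ) (b : Fin m → ℝ) (r x : ℝ) :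
    detInv t ((J (Fin.snoc (α := fun _ => ℝ) b 0), Pi.single (Fin.last m) (r : ℂ), x) :
      LieGDual (m + 1)) = (((2 * x * t + r ^ 2) * ∏ j, (t - b j) : ℝ) : ℂ) := by
  rw [detInv_diagonal]
  congr 1
  rw [Finset.sum_eq_single (Fin.last m)]
  · have : Finset.univ.erase (Fin.last m) = Finset.univ.map Fin.castSuccEmb := by
      ext i
      induction i using Fin.lastCases with
      | last => simp [Fin.castSucc_ne_last]
      | cast i => simp [Fin.castSucc_ne_last]
    rw [this, Finset.prod_map, Fin.prod_univ_castSucc]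
    simp
    ring
  · intro i _ hi
    simp [hi]
  · simp

/-- The invariant `|u|² - 2x tr H`, where `U = iH`. -/
def traceInv (l : LieGDual n) : ℝ := ∑ i, ‖l.2.1 i‖ ^ 2 - 2 * l.2.2 * (trace l.1.1).im

theorem trace_cross_self (z w : Fin n → ℂ) : (trace (cross z w)).im = (star z ⬝ᵥ w).re := by
  rw [cross, trace_smul, trace_add, trace_vecMulVec, trace_vecMulVec]
  have : z ⬝ᵥ star w = star (star z ⬝ᵥ w) := by
    rw [dotProduct_star, dotProduct_comm w]
  rw [this, dotProduct_comm w]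
  simp [Complex.mul_im]
  ring

theorem sum_norm_sq (u : Fin n → ℂ) : ((∑ i, ‖u i‖ ^ 2 : ℝ)) = (star u ⬝ᵥ u).re := by
  simp [dotProduct, Complex.conj_mul', ← Complex.ofReal_pow]

/-- The terms `2x Re⟨Au,z⟩` and `x²|z|²` of `|Au + xz|²` are cancelled by the traces of `z × Au` and
`(x/2) z × z`. -/
theorem traceInv_smul (g : G n) (l : LieGDual n) : traceInv (g • l) = traceInv l := by
  have hu : star (g.mat *ᵥ l.2.1) ⬝ᵥ (g.mat *ᵥ l.2.1) = star l.2.1 ⬝ᵥ l.2.1 := by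
    rw [star_mulVec, ← dotProduct_mulVec, mulVec_mulVec, unitary_conj_mul, one_mulVec]
  have ht : trace (g.mat * l.1.1 * g.matᴴ) = trace l.1.1 := by
    rw [trace_mul_comm, ← mul_assoc, unitary_conj_mul, one_mul]
  have hs : (star (g.mat *ᵥ l.2.1) ⬝ᵥ g.z).re = (star g.z ⬝ᵥ (g.mat *ᵥ l.2.1)).re := by
    have : star (g.mat *ᵥ l.2.1) ⬝ᵥ g.z = star (star g.z ⬝ᵥ (g.mat *ᵥ l.2.1)) :=
      star_dotProduct _ _
    rw [this]
    simp
  simp only [traceInv, sum_norm_sq, smul_fst, smul_snd, smul_trd, trace_add, trace_smul, ht,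
    Complex.add_im, Complex.smul_im, trace_cross_self, star_add, add_dotProduct, dotProduct_add,
    star_smul, smul_dotProduct, dotProduct_smul, hu, Complex.add_re, smul_eq_mul]
  simp [hs]
  ring

theorem continuous_traceInv : Continuous (traceInv (n := n)) := by
  have hU : Continuous fun l : LieGDual n => (trace l.1.1).im :=
    Complex.continuous_im.comp (continuous_coe_fst (n := n)).matrix_trace
  have hu : Continuous fun l : LieGDual n => l.2.1 := continuous_fst.comp continuous_snd
  have hx : Continuous fun l : LieGDual n => l.2.2 := continuous_snd.comp continuous_snd
  unfold traceInv
  fun_prop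

theorem traceInv_diagonal (d : Fin n → ℝ) (u : Fin n → ℂ) (x : ℝ) :
    traceInv (J d, u, x) = ∑ i, ‖u i‖ ^ 2 - 2 * x * ∑ i, d i := by
  simp [traceInv, J, trace_diagonal]

theorem traceInv_single {m : ℕ} (b : Fin m → ℝ) (r : ℝ) :
    traceInv ((J (Fin.snoc (α := fun _ => ℝ) b 0), Pi.single (Fin.last m) (r : ℂ), 0) :
      LieGDual (m + 1)) = r ^ 2 := by
  rw [traceInv_diagonal, Finset.sum_eq_single (Fin.last m)]
  · simp
  · intro i _ hi
    simp [hi]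
  · simp

end Invariants

/-! ### Limits of polynomials with integral roots -/

section IntegralRoots

/-- The value at `t` of the monic polynomial with the multiset of roots `S`. -/
def rootProd (S : Multiset ℤ) (t : ℝ) : ℝ := (S.map fun a : ℤ => t - (a : ℝ)).prod

theorem rootProd_cons (b : ℤ) (S : Multiset ℤ) (t : ℝ) :
    rootProd (b ::ₘ S) t = (t - b) * rootProd S t := by simp [rootProd]

theorem rootProd_ne_zero (S : Multiset ℤ) {t : ℝ} (ht : ∀ a : ℤ, t ≠ a) : rootProd S t ≠ 0 := by
  rw [rootProd]
  refine Multiset.prod_ne_zero fun h => ?_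
  obtain ⟨a, _, ha⟩ := Multiset.mem_map.1 h
  exact ht a (sub_eq_zero.1 ha)

theorem continuous_rootProd (S : Multiset ℤ) : Continuous (rootProd S) := by
  induction S using Multiset.induction with
  | empty =>
    have : rootProd 0 = fun _ => 1 := by ext t; simp [rootProd]
    rw [this]
    exact continuous_const
  | cons b S ih =>
    have : rootProd (b ::ₘ S) = fun t => (t - b) * rootProd S t := funext (rootProd_cons b S)
    rw [this]
    fun_prop

/-- For an integer root `a ≠ b`, moving from `b + e` to `b + 1/2` at most doubles the distance to
`a`. -/
theorem abs_rootProd_le {S : Multiset ℤ} {b : ℤ} (hb : b ∉ S) {e : ℝ} (he : 0 < e)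
    (he' : e < 1 / 2) :
    |rootProd S (b + 1 / 2)| ≤ 2 ^ S.card * |rootProd S (b + e)| := by
  induction S using Multiset.induction with
  | empty => simp [rootProd]
  | cons a S ih =>
    rw [Multiset.mem_cons, not_or] at hb
    have key : |(b : ℝ) + 1 / 2 - a| ≤ 2 * |(b : ℝ) + e - a| := by
      rcases lt_or_gt_of_ne hb.1 with h | h
      · have : (b : ℝ) + 1 ≤ a := by exact_mod_cast h
        rw [abs_of_nonpos (by linarith), abs_of_nonpos (by linarith)]
        linarith
      · have : (a : ℝ) + 1 ≤ b := by exact_mod_cast h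
        rw [abs_of_nonneg (by linarith), abs_of_nonneg (by linarith)]
        linarith
    rw [rootProd_cons, rootProd_cons, abs_mul, abs_mul, Multiset.card_cons, pow_succ]
    calc _ ≤ (2 * |(b : ℝ) + e - a|) * (2 ^ S.card * |rootProd S (b + e)|) :=
          mul_le_mul key (ih hb.2) (abs_nonneg _) (by positivity)
      _ = _ := by ring

theorem not_int_of_between {b : ℤ} {e : ℝ} (he : 0 < e) (he' : e < 1) (a : ℤ) :
    (b : ℝ) + e ≠ a := by
  intro h
  have h1 : (b : ℝ) < a := by linarith
  have h2 : (a : ℝ) < b + 1 := by linarith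
  norm_cast at h1 h2
  omega

/-- If `b` is not a root, the value at `b + 1/2` is at most `2^N` times the value at `b + e`. The
limit polynomial vanishes at `b` but not at `b + 1/2`, so a small `e` violates this bound
eventually. -/
theorem eventually_mem_of_tendsto {S : ℕ → Multiset ℤ} {c : ℕ → ℝ} {c₀ : ℝ} (hc₀ : c₀ ≠ 0) {N : ℕ}
    (hN : ∀ k, (S k).card ≤ N) {b : ℤ} {T : Multiset ℤ}
    (h : ∀ t : ℝ, (∀ a : ℤ, t ≠ a) →
      Tendsto (fun k => c k * rootProd (S k) t) atTop (𝓝 (c₀ * rootProd (b ::ₘ T) t))) :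
    ∀ᶠ k in atTop, b ∈ S k := by
  have hpos : 0 < |c₀ * rootProd (b ::ₘ T) (b + 1 / 2)| :=
    abs_pos.2 (mul_ne_zero hc₀ (rootProd_ne_zero _
      (not_int_of_between (by norm_num) (by norm_num))))
  have hcont : Continuous fun e : ℝ => 2 ^ N * |c₀ * rootProd (b ::ₘ T) (b + e)| := by
    have := continuous_rootProd (b ::ₘ T)
    fun_prop
  have hlt : ∀ᶠ e : ℝ in 𝓝[>] 0, 2 ^ N * |c₀ * rootProd (b ::ₘ T) (b + e)| <
      |c₀ * rootProd (b ::ₘ T) (b + 1 / 2)| :=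
    nhdsWithin_le_nhds (hcont.continuousAt.eventually_lt continuousAt_const
      (by simpa [rootProd_cons] using hpos))
  have hsm : ∀ᶠ e : ℝ in 𝓝[>] 0, e ∈ Set.Ioo (0 : ℝ) (1 / 2) :=
    Ioo_mem_nhdsGT (by norm_num)
  obtain ⟨e, hlt, he, he'⟩ := (hlt.and hsm).exists
  have h1 := ((h _ (not_int_of_between (b := b) he (by linarith))).abs.const_mul (2 ^ N))
  have h2 := (h _ (not_int_of_between (b := b) (e := 1 / 2) (by norm_num) (by norm_num))).abs
  filter_upwards [h1.eventually_lt h2 hlt] with k hk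
  by_contra hb
  refine absurd hk (not_lt.2 ?_)
  rw [abs_mul, abs_mul]
  calc |c k| * |rootProd (S k) (b + 1 / 2)|
      ≤ |c k| * (2 ^ (S k).card * |rootProd (S k) (b + e)|) :=
        mul_le_mul_of_nonneg_left (abs_rootProd_le hb he he') (abs_nonneg _)
    _ ≤ |c k| * (2 ^ N * |rootProd (S k) (b + e)|) := by
        gcongr
        · norm_num
        · exact hN k
    _ = _ := by ring

/-- If real multiples of monic polynomials of bounded degree with integral roots converge to a
nonzero polynomial with integral roots, then the roots of the limit are eventually among the roots
of the members of the sequence. -/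
theorem eventually_le_of_tendsto (T : Multiset ℤ) {S : ℕ → Multiset ℤ} {c : ℕ → ℝ} {c₀ : ℝ}
    (hc₀ : c₀ ≠ 0) {N : ℕ} (hN : ∀ k, (S k).card ≤ N)
    (h : ∀ t : ℝ, (∀ a : ℤ, t ≠ a) →
      Tendsto (fun k => c k * rootProd (S k) t) atTop (𝓝 (c₀ * rootProd T t))) :
    ∀ᶠ k in atTop, T ≤ S k := by
  induction T using Multiset.induction generalizing S with
  | empty => simp
  | cons b T ih =>
    have hb := eventually_mem_of_tendsto hc₀ hN h
    -- Divide by `t - b` and induct; this is why convergence is only assumed at nonintegral `t`.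
    have hT : ∀ᶠ k in atTop, T ≤ (S k).erase b := by
      refine ih (fun k => (Multiset.card_le_card (Multiset.erase_le b _)).trans (hN k))
        fun t ht => ?_
      have hne : t - b ≠ 0 := sub_ne_zero.2 (ht b)
      have hlim := (h t ht).mul_const (t - b)⁻¹
      rw [rootProd_cons] at hlim
      have hval : c₀ * ((t - b) * rootProd T t) * (t - b)⁻¹ = c₀ * rootProd T t := by
        field_simp
      rw [hval] at hlim
      refine hlim.congr' ?_
      filter_upwards [hb] with k hk
      have : rootProd (S k) t = (t - b) * rootProd ((S k).erase b) t := by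
        rw [← rootProd_cons, Multiset.cons_erase hk]
      rw [this]
      field_simp
    filter_upwards [hb, hT] with k hk hTk
    rw [← Multiset.cons_erase hk]
    exact Multiset.cons_le_cons b hTk

/-- The multiset of entries of an integer tuple. -/
def entries {n : ℕ} (f : Fin n → ℤ) : Multiset ℤ := Finset.univ.val.map f

@[simp] theorem card_entries {n : ℕ} (f : Fin n → ℤ) : (entries f).card = n := by
  simp [entries]

theorem rootProd_entries {n : ℕ} (f : Fin n → ℤ) (t : ℝ) :
    rootProd (entries f) t = ∏ i, (t - (f i : ℝ)) := by
  rw [rootProd, entries, Multiset.map_map]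
  rfl

/-- Equal multiplicities give bijections between the fibres over each value; these glue to a
permutation. -/
theorem exists_perm_of_entries_eq {n : ℕ} {α : Type*} {f g : Fin n → α}
    (h : Finset.univ.val.map f = Finset.univ.val.map g) : ∃ σ : Equiv.Perm (Fin n), f = g ∘ σ := by
  classical
  have hcard : ∀ a, Fintype.card {i // f i = a} = Fintype.card {i // g i = a} := by
    intro a
    have := congrArg (Multiset.count a) h
    rw [Multiset.count_map, Multiset.count_map] at this
    rw [Fintype.card_subtype, Fintype.card_subtype]
    simpa [Finset.card, eq_comm] using this
  let e : ∀ a, {i // f i = a} ≃ {i // g i = a} := fun a => Fintype.equivOfCardEq (hcard a)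
  refine ⟨((Equiv.sigmaFiberEquiv f).symm.trans (Equiv.sigmaCongrRight e)).trans
    (Equiv.sigmaFiberEquiv g), funext fun i => ?_⟩
  exact (e (f i) ⟨i, rfl⟩).2.symm

theorem antitone_eq_of_map_eq {n : ℕ} {α : Type*} [PartialOrder α] {f g : Fin n → α}
    (hf : Antitone f) (hg : Antitone g)
    (h : Finset.univ.val.map f = Finset.univ.val.map g) : f = g := by
  obtain ⟨σ, rfl⟩ := exists_perm_of_entries_eq h
  exact Tuple.unique_antitone (σ := σ) (τ := 1) hf hg

/-- A limit of multiples of polynomials with integral roots, with degrees preserved. -/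
theorem eventually_eq_of_tendsto {n : ℕ} {F : ℕ → Weight n} {f : Weight n} {c : ℕ → ℝ} {c₀ : ℝ}
    (hc₀ : c₀ ≠ 0)
    (h : ∀ t : ℝ, Tendsto (fun k => c k * ∏ i, (t - ((F k).1 i : ℝ))) atTop
      (𝓝 (c₀ * ∏ i, (t - (f.1 i : ℝ))))) :
    ∀ᶠ k in atTop, F k = f := by
  have := eventually_le_of_tendsto (entries f.1) (S := fun k => entries (F k).1) hc₀ (N := n)
    (by simp) (fun t _ => by simpa only [rootProd_entries] using h t)
  filter_upwards [this] with k hk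
  have heq := Multiset.eq_of_le_of_card_le hk (by simp)
  exact Subtype.ext (antitone_eq_of_map_eq (F k).2 f.2 heq.symm)

end IntegralRoots

/-! ### Min-max comparison of quadratic forms -/

section MinMax

variable {n : ℕ}

/-- The quadratic form of the Hermitian matrix `-iU`. -/
def hForm (U : Matrix (Fin n) (Fin n) ℂ) (x : Fin n → ℂ) : ℝ := (star x ⬝ᵥ (U *ᵥ x)).im

theorem hForm_add (U V : Matrix (Fin n) (Fin n) ℂ) (x : Fin n → ℂ) :
    hForm (U + V) x = hForm U x + hForm V x := by
  simp [hForm, add_mulVec]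

theorem hForm_sub (U V : Matrix (Fin n) (Fin n) ℂ) (x : Fin n → ℂ) :
    hForm (U - V) x = hForm U x - hForm V x := by
  simp [hForm, sub_mulVec]

theorem hForm_smul (c : ℝ) (U : Matrix (Fin n) (Fin n) ℂ) (x : Fin n → ℂ) :
    hForm (c • U) x = c * hForm U x := by
  simp [hForm, smul_mulVec]

theorem hForm_conj (M U : Matrix (Fin n) (Fin n) ℂ) (x : Fin n → ℂ) :
    hForm (M * U * Mᴴ) x = hForm U (Mᴴ *ᵥ x) := by
  rw [hForm, hForm, star_mulVec, conjTranspose_conjTranspose, ← dotProduct_mulVec,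
    mulVec_mulVec, mulVec_mulVec]

theorem hForm_J (d : Fin n → ℝ) (x : Fin n → ℂ) : hForm (J d).1 x = ∑ l, d l * ‖x l‖ ^ 2 := by
  simp only [hForm, J, dotProduct, mulVec_diagonal, Complex.im_sum]
  refine Finset.sum_congr rfl fun l _ => ?_
  have : (star x) l * (Complex.I * d l * x l) = Complex.I * ((d l * ‖x l‖ ^ 2 : ℝ) : ℂ) := by
    push_cast
    rw [← Complex.conj_mul']
    simp
    ring
  rw [this]
  simp only [Complex.I_mul_im, Complex.ofReal_re]

theorem cross_mulVec (z w x : Fin n → ℂ) :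
    cross z w *ᵥ x = (Complex.I / 2) • ((star z ⬝ᵥ x) • w + (star w ⬝ᵥ x) • z) := by
  rw [cross, smul_mulVec, add_mulVec, vecMulVec_mulVec, vecMulVec_mulVec]
  simp

theorem hForm_cross_of_orthogonal {z w x : Fin n → ℂ} (h : star w ⬝ᵥ x = 0) :
    hForm (cross z w) x = 0 := by
  have h' : star x ⬝ᵥ w = 0 := by rw [star_dotProduct, h, star_zero]
  simp [hForm, cross_mulVec, h, h']

theorem hForm_cross_self (z x : Fin n → ℂ) : hForm (cross z z) x = ‖star z ⬝ᵥ x‖ ^ 2 := by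
  have h' : star x ⬝ᵥ z = star (star z ⬝ᵥ x) := star_dotProduct _ _
  simp only [hForm, cross_mulVec, dotProduct_smul, dotProduct_add, h', smul_eq_mul]
  have : Complex.I / 2 * ((star z ⬝ᵥ x) * star (star z ⬝ᵥ x) + (star z ⬝ᵥ x) * star (star z ⬝ᵥ x))
      = Complex.I * ((‖star z ⬝ᵥ x‖ ^ 2 : ℝ) : ℂ) := by
    push_cast
    rw [← Complex.mul_conj']
    simp
    ring
  rw [this]
  simp only [Complex.I_mul_im, Complex.ofReal_re]

theorem sum_norm_sq_unitary (g : G n) (x : Fin n → ℂ) :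
    ∑ l, ‖(g.matᴴ *ᵥ x) l‖ ^ 2 = ∑ l, ‖x l‖ ^ 2 := by
  rw [sum_norm_sq, sum_norm_sq, star_mulVec, conjTranspose_conjTranspose, ← dotProduct_mulVec,
    mulVec_mulVec, mat_mul_conj, one_mulVec]

theorem abs_hForm_le (U : Matrix (Fin n) (Fin n) ℂ) (x : Fin n → ℂ) :
    |hForm U x| ≤ (∑ i, ∑ j, ‖U i j‖) * ∑ l, ‖x l‖ ^ 2 := by
  have hx : ∀ i j, ‖x i‖ * ‖x j‖ ≤ ∑ l, ‖x l‖ ^ 2 := by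
    intro i j
    have hi := Finset.single_le_sum (f := fun l => ‖x l‖ ^ 2) (fun l _ => sq_nonneg _)
      (Finset.mem_univ i)
    have hj := Finset.single_le_sum (f := fun l => ‖x l‖ ^ 2) (fun l _ => sq_nonneg _)
      (Finset.mem_univ j)
    nlinarith [sq_nonneg (‖x i‖ - ‖x j‖)]
  calc |hForm U x| ≤ ‖star x ⬝ᵥ (U *ᵥ x)‖ := Complex.abs_im_le_norm _
    _ ≤ ∑ i, ∑ j, ‖U i j‖ * ∑ l, ‖x l‖ ^ 2 := by
        refine (norm_sum_le _ _).trans (Finset.sum_le_sum fun i _ => ?_)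
        rw [norm_mul, mulVec, dotProduct]
        refine (mul_le_mul_of_nonneg_left (norm_sum_le _ _) (norm_nonneg _)).trans ?_
        rw [Finset.mul_sum]
        refine Finset.sum_le_sum fun j _ => ?_
        rw [norm_mul]
        calc ‖(star x) i‖ * (‖U i j‖ * ‖x j‖) = ‖U i j‖ * (‖x i‖ * ‖x j‖) := by
              simp; ring
          _ ≤ _ := mul_le_mul_of_nonneg_left (hx i j) (norm_nonneg _)
    _ = _ := by simp only [Finset.sum_mul]

/-- Dimension count: fewer than `n` linear conditions leave a common nonzero solution. The map `f`
is either trivial or the functional that kills a rank one term. -/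
theorem exists_ne_zero_of_card_lt {F : Type*} [AddCommGroup F] [Module ℂ F] [FiniteDimensional ℂ F]
    (M : Matrix (Fin n) (Fin n) ℂ) (P Q : Finset (Fin n)) (f : (Fin n → ℂ) →ₗ[ℂ] F)
    (h : P.card + Q.card + Module.finrank ℂ F < n) :
    ∃ x : Fin n → ℂ, x ≠ 0 ∧ (∀ l ∈ P, x l = 0) ∧ (∀ l ∈ Q, (M *ᵥ x) l = 0) ∧ f x = 0 := by
  let φ : (Fin n → ℂ) →ₗ[ℂ] ((P → ℂ) × (Q → ℂ)) × F :=
    (((LinearMap.funLeft ℂ ℂ (fun l : P => (l : Fin n)))).prod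
      ((LinearMap.funLeft ℂ ℂ (fun l : Q => (l : Fin n))).comp M.mulVecLin)).prod f
  have hker : LinearMap.ker φ ≠ ⊥ := LinearMap.ker_ne_bot_of_finrank_lt (by simpa using h)
  obtain ⟨x, hx, hx0⟩ := Submodule.exists_mem_ne_zero_of_ne_bot hker
  rw [LinearMap.mem_ker] at hx
  have h1 := congrArg (fun y => y.1.1) hx
  have h2 := congrArg (fun y => y.1.2) hx
  have h3 := congrArg (fun y => y.2) hx
  exact ⟨x, hx0, fun l hl => congrFun h1 ⟨l, hl⟩, fun l hl => congrFun h2 ⟨l, hl⟩, h3⟩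

theorem sum_norm_sq_pos {x : Fin n → ℂ} (hx : x ≠ 0) : 0 < ∑ l, ‖x l‖ ^ 2 := by
  obtain ⟨i, hi⟩ := Function.ne_iff.1 hx
  exact Finset.sum_pos' (fun l _ => sq_nonneg _) ⟨i, Finset.mem_univ i, by
    have : 0 < ‖x i‖ := norm_pos_iff.2 hi
    positivity⟩

/-- The comparison step of the min-max principle, for integral spectra. -/
theorem le_of_form_lt {F : Type*} [AddCommGroup F] [Module ℂ F] [FiniteDimensional ℂ F]
    {q : (Fin n → ℂ) → ℝ} (g : G n) {d e : Fin n → ℤ} {s t : ℤ} (P Q : Finset (Fin n))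
    (f : (Fin n → ℂ) →ₗ[ℂ] F) (hdim : P.card + Q.card + Module.finrank ℂ F < n)
    (hq : ∀ x, (∀ l ∈ Q, (g.matᴴ *ᵥ x) l = 0) → f x = 0 →
      ∑ l, (d l : ℝ) * ‖(g.matᴴ *ᵥ x) l‖ ^ 2 ≤ q x)
    (hclose : ∀ x, x ≠ 0 → q x < ∑ l, (e l : ℝ) * ‖x l‖ ^ 2 + ∑ l, ‖x l‖ ^ 2)
    (hd : ∀ l, l ∉ Q → s ≤ d l) (he : ∀ l, l ∉ P → e l ≤ t) : s ≤ t := by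
  obtain ⟨x, hx0, hP, hQ, hf⟩ := exists_ne_zero_of_card_lt g.matᴴ P Q f hdim
  have hpos := sum_norm_sq_pos hx0
  have h1 : (s : ℝ) * ∑ l, ‖x l‖ ^ 2 ≤ ∑ l, (d l : ℝ) * ‖(g.matᴴ *ᵥ x) l‖ ^ 2 := by
    rw [← sum_norm_sq_unitary g, Finset.mul_sum]
    refine Finset.sum_le_sum fun l _ => ?_
    by_cases hl : l ∈ Q
    · simp [hQ l hl]
    · exact mul_le_mul_of_nonneg_right (by exact_mod_cast hd l hl) (sq_nonneg _)
  have h2 : ∑ l, (e l : ℝ) * ‖x l‖ ^ 2 ≤ (t : ℝ) * ∑ l, ‖x l‖ ^ 2 := by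
    rw [Finset.mul_sum]
    refine Finset.sum_le_sum fun l _ => ?_
    by_cases hl : l ∈ P
    · simp [hP l hl]
    · exact mul_le_mul_of_nonneg_right (by exact_mod_cast he l hl) (sq_nonneg _)
  -- An error smaller than `|x|²` gives `s < t + 1`, which suffices because `s` and `t` are
  -- integers.
  have h3 : (s : ℝ) * ∑ l, ‖x l‖ ^ 2 < ((t + 1 : ℤ) : ℝ) * ∑ l, ‖x l‖ ^ 2 := by
    push_cast
    linarith [hclose x hx0, hq x hQ hf]
  have h4 : (s : ℝ) < ((t + 1 : ℤ) : ℝ) := lt_of_mul_lt_mul_right h3 hpos.le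
  exact Int.lt_add_one_iff.1 (by exact_mod_cast h4)

theorem le_of_lt_form {F : Type*} [AddCommGroup F] [Module ℂ F] [FiniteDimensional ℂ F]
    {q : (Fin n → ℂ) → ℝ} (g : G n) {d e : Fin n → ℤ} {s t : ℤ} (P Q : Finset (Fin n))
    (f : (Fin n → ℂ) →ₗ[ℂ] F) (hdim : P.card + Q.card + Module.finrank ℂ F < n)
    (hq : ∀ x, (∀ l ∈ Q, (g.matᴴ *ᵥ x) l = 0) → f x = 0 →
      q x ≤ ∑ l, (d l : ℝ) * ‖(g.matᴴ *ᵥ x) l‖ ^ 2)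
    (hclose : ∀ x, x ≠ 0 → ∑ l, (e l : ℝ) * ‖x l‖ ^ 2 < q x + ∑ l, ‖x l‖ ^ 2)
    (hd : ∀ l, l ∉ Q → d l ≤ s) (he : ∀ l, l ∉ P → t ≤ e l) : t ≤ s := by
  refine neg_le_neg_iff.1 (le_of_form_lt (q := fun x => -q x) g (d := fun l => -d l)
    (e := fun l => -e l) P Q f hdim ?_ ?_ (fun l hl => neg_le_neg (hd l hl))
    (fun l hl => neg_le_neg (he l hl)))
  · intro x h1 h2
    simpa using hq x h1 h2
  · intro x hx
    have := hclose x hx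
    simp only [Int.cast_neg, neg_mul, Finset.sum_neg_distrib]
    linarith

/-- The linear form `x ↦ ⟨x, z⟩`. -/
def coForm (z : Fin n → ℂ) : (Fin n → ℂ) →ₗ[ℂ] ℂ where
  toFun x := star z ⬝ᵥ x
  map_add' _ _ := dotProduct_add _ _ _
  map_smul' _ _ := dotProduct_smul _ _ _

/-- The quadratic forms `q` and `∑ e_l |x_l|²` differ by less than `|x|²`. -/
def FormClose (q : (Fin n → ℂ) → ℝ) (e : Fin n → ℤ) : Prop :=
  ∀ x, x ≠ 0 → |q x - ∑ l, (e l : ℝ) * ‖x l‖ ^ 2| < ∑ l, ‖x l‖ ^ 2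

theorem FormClose.lt_add {q : (Fin n → ℂ) → ℝ} {e : Fin n → ℤ} (h : FormClose q e)
    {x : Fin n → ℂ} (hx : x ≠ 0) : q x < ∑ l, (e l : ℝ) * ‖x l‖ ^ 2 + ∑ l, ‖x l‖ ^ 2 := by
  linarith [(abs_lt.1 (h x hx)).2]

theorem FormClose.lt_add' {q : (Fin n → ℂ) → ℝ} {e : Fin n → ℤ} (h : FormClose q e)
    {x : Fin n → ℂ} (hx : x ≠ 0) : ∑ l, (e l : ℝ) * ‖x l‖ ^ 2 < q x + ∑ l, ‖x l‖ ^ 2 := by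
  linarith [(abs_lt.1 (h x hx)).1]

/-- The sum of the absolute values of the entries bounds a quadratic form, so a perturbation with
this sum below 1 is admissible. -/
theorem formClose_eventually (d : Fin n → ℤ) (y : LieGDual n)
    (hy : y.1 = J fun j => (d j : ℝ)) :
    ∀ᶠ l : LieGDual n in 𝓝 y, FormClose (hForm l.1.1) d := by
  have hc : Continuous fun l : LieGDual n => ∑ i, ∑ j, ‖(l.1.1 - y.1.1) i j‖ :=
    continuous_finsetSum _ fun i _ => continuous_finsetSum _ fun j _ =>
      ((continuous_coe_fst.sub continuous_const).matrix_elem i j).norm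
  have h1 : ∀ᶠ l : LieGDual n in 𝓝 y, ∑ i, ∑ j, ‖(l.1.1 - y.1.1) i j‖ < 1 :=
    hc.continuousAt.eventually_lt continuousAt_const (by simp)
  filter_upwards [h1] with l hl x hx
  have h2 := abs_hForm_le (l.1.1 - y.1.1) x
  rw [hForm_sub, hy, hForm_J] at h2
  refine h2.trans_lt ?_
  rw [← hy]
  exact mul_lt_of_lt_one_left (sum_norm_sq_pos hx) hl

/-! ### Interlacing for rank one perturbations and compressions -/

section Interlacing

variable {m : ℕ} {q : (Fin (m + 1) → ℂ) → ℝ} (g : G (m + 1)) {d e : Weight (m + 1)}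
  {z : Fin (m + 1) → ℂ} {c : ℝ}

/-- Adding a nonnegative form raises ordered eigenvalues. The conditions number `j + (m - j) = m`,
one fewer than the dimension. -/
theorem rankOne_le (hc : 0 ≤ c)
    (hq : ∀ x, q x = ∑ l, (d.1 l : ℝ) * ‖(g.matᴴ *ᵥ x) l‖ ^ 2 + c * ‖star z ⬝ᵥ x‖ ^ 2)
    (h : FormClose q e.1) (j : Fin (m + 1)) : d.1 j ≤ e.1 j := by
  refine le_of_form_lt (F := Fin 0 → ℂ) g (Finset.Iio j) (Finset.Ioi j) 0 ?_
    (fun x _ _ => ?_) (fun x => h.lt_add) (fun l hl => d.2 (by simpa using hl))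
    (fun l hl => e.2 (by simpa using hl))
  · simp
    omega
  · rw [hq x]
    have := mul_nonneg hc (sq_nonneg ‖star z ⬝ᵥ x‖)
    linarith

theorem rankOne_ge (hc : c ≤ 0)
    (hq : ∀ x, q x = ∑ l, (d.1 l : ℝ) * ‖(g.matᴴ *ᵥ x) l‖ ^ 2 + c * ‖star z ⬝ᵥ x‖ ^ 2)
    (h : FormClose q e.1) (j : Fin (m + 1)) : e.1 j ≤ d.1 j := by
  refine le_of_lt_form (F := Fin 0 → ℂ) g (Finset.Ioi j) (Finset.Iio j) 0 ?_
    (fun x _ _ => ?_) (fun x => h.lt_add') (fun l hl => d.2 (by simpa using hl))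
    (fun l hl => e.2 (by simpa using hl))
  · simp
    omega
  · rw [hq x]
    have := mul_nonneg (neg_nonneg.2 hc) (sq_nonneg ‖star z ⬝ᵥ x‖)
    linarith

/-- On the hyperplane orthogonal to `z` the perturbation vanishes, whatever the sign of `c`. This
extra condition costs one dimension, hence the index shift. -/
theorem rankOne_succ_le
    (hq : ∀ x, q x = ∑ l, (d.1 l : ℝ) * ‖(g.matᴴ *ᵥ x) l‖ ^ 2 + c * ‖star z ⬝ᵥ x‖ ^ 2)
    (h : FormClose q e.1) (j : Fin m) : d.1 j.succ ≤ e.1 j.castSucc := by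
  refine le_of_form_lt g (Finset.Iio j.castSucc) (Finset.Ioi j.succ) (coForm z) ?_
    (fun x _ hx => ?_) (fun x => h.lt_add) (fun l hl => d.2 (by simpa using hl))
    (fun l hl => e.2 (by simpa using hl))
  · simp
    omega
  · have hx' : star z ⬝ᵥ x = 0 := hx
    simp [hq x, hx']

theorem rankOne_succ_ge
    (hq : ∀ x, q x = ∑ l, (d.1 l : ℝ) * ‖(g.matᴴ *ᵥ x) l‖ ^ 2 + c * ‖star z ⬝ᵥ x‖ ^ 2)
    (h : FormClose q e.1) (j : Fin m) : e.1 j.succ ≤ d.1 j.castSucc := by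
  refine le_of_lt_form g (Finset.Ioi j.succ) (Finset.Iio j.castSucc) (coForm z) ?_
    (fun x _ hx => ?_) (fun x => h.lt_add') (fun l hl => d.2 (by simpa using hl))
    (fun l hl => e.2 (by simpa using hl))
  · simp
    omega
  · have hx' : star z ⬝ᵥ x = 0 := hx
    simp [hq x, hx']

theorem hForm_smul_gen (d : Fin (m + 1) → ℝ) (a : ℝ) (x : Fin (m + 1) → ℂ) :
    hForm (g • ((J d, 0, a) : LieGDual (m + 1))).1.1 x =
      ∑ l, d l * ‖(g.matᴴ *ᵥ x) l‖ ^ 2 + a / 2 * ‖star g.z ⬝ᵥ x‖ ^ 2 := by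
  rw [smul_fst, hForm_add, hForm_add, hForm_conj, hForm_J, hForm_smul, hForm_cross_self]
  simp [cross, hForm]

theorem interlace_of_formClose_of_pos {a : ℝ} (ha : 0 < a)
    (h : FormClose (hForm (g • ellGen d a).1.1) e.1) : Interlace e d :=
  ⟨rankOne_le g (by positivity) (hForm_smul_gen g _ a) h,
    rankOne_succ_ge g (hForm_smul_gen g _ a) h⟩

theorem interlace_of_formClose_of_neg {a : ℝ} (ha : a < 0)
    (h : FormClose (hForm (g • ellGen d a).1.1) e.1) : Interlace d e :=
  ⟨rankOne_ge g (by linarith) (hForm_smul_gen g _ a) h,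
    rankOne_succ_le g (hForm_smul_gen g _ a) h⟩

theorem eq_of_formClose (h : FormClose (hForm (g • ellU d).1.1) e.1) : d = e :=
  Subtype.ext (funext fun j => le_antisymm
    (rankOne_le g (by simp) (hForm_smul_gen g _ 0) h j)
    (rankOne_ge g (by simp) (hForm_smul_gen g _ 0) h j))

/-- On the hyperplane orthogonal to the moved vector `Au` the term `z × Au` contributes nothing, so
the form there is that of `diag(μ)`. -/
theorem interlaceShort_of_formClose {mu : Weight m} {r : ℝ}
    (h : FormClose (hForm (g • ellMid mu r).1.1) e.1) : InterlaceShort e mu := by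
  -- The last entry plays no role: the corresponding coordinate is always required to vanish.
  let d : Fin (m + 1) → ℤ := Fin.snoc (α := fun _ => ℤ) mu.1 0
  have hd : (fun j => (d j : ℝ)) = Fin.snoc (α := fun _ => ℝ) (fun j => (mu.1 j : ℝ)) 0 := by
    ext j
    induction j using Fin.lastCases <;> simp [d]
  have hq : ∀ x, (g.matᴴ *ᵥ x) (Fin.last m) = 0 →
      hForm (g • ellMid mu r).1.1 x = ∑ l, (d l : ℝ) * ‖(g.matᴴ *ᵥ x) l‖ ^ 2 := by
    intro x hx
    have h0 : star (g.mat *ᵥ Pi.single (Fin.last m) (r : ℂ)) ⬝ᵥ x = 0 := by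
      rw [star_mulVec, ← dotProduct_mulVec]
      simp [dotProduct, Pi.single_apply, hx, apply_ite]
    rw [smul_fst, hForm_add, hForm_add]
    simp only [ellMid]
    rw [hForm_conj, hForm_J, hForm_cross_of_orthogonal h0, hForm_smul]
    simp [← hd]
  intro j
  constructor
  · refine le_of_form_lt (F := Fin 0 → ℂ) g (d := d) (Finset.Iio j.castSucc)
      (Finset.Ioi j.castSucc) 0 ?_ (fun x hx _ => (hq x (hx _ ?_)).ge) (fun x => h.lt_add)
      (fun l hl => ?_) (fun l hl => e.2 (by simpa using hl))
    · simp
    · simp [Fin.castSucc_lt_last]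
    · induction l using Fin.lastCases with
      | last => simp [Fin.castSucc_lt_last] at hl
      | cast l => simpa [d] using mu.2 (by simpa using hl)
  -- In this direction the index set does not contain the last coordinate by itself, so it is
  -- inserted; it uses up the one dimension that the shift to `j.succ` releases.
  · refine le_of_lt_form (F := Fin 0 → ℂ) g (d := d) (Finset.Ioi j.succ)
      (insert (Fin.last m) (Finset.Iio j.castSucc)) 0 ?_
      (fun x hx _ => (hq x (hx _ (by simp))).le) (fun x => h.lt_add')
      (fun l hl => ?_) (fun l hl => e.2 (by simpa using hl))
    · rw [Finset.card_insert_of_notMem (by simp [Fin.le_last])]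
      simp
    · induction l using Fin.lastCases with
      | last => simp at hl
      | cast l =>
        simp only [Finset.mem_insert, Finset.mem_Iio, not_or, not_lt] at hl
        simpa [d] using mu.2 (by simpa using hl.2)

end Interlacing
end MinMax

/-! ### Normal forms of coadjoint orbits -/

section NormalForm

open scoped InnerProductSpace

variable {n : ℕ}

/-- A skew-Hermitian matrix can be diagonalised by an orthonormal basis after compression to
a subspace. -/
theorem exists_orthonormal_diagonalizing {p : ℕ} (U : LieU n)
    (V : Submodule ℂ (EuclideanSpace ℂ (Fin n))) (hV : Module.finrank ℂ V = p) :
    ∃ (v : Fin p → EuclideanSpace ℂ (Fin n)) (b : Fin p → ℝ), Orthonormal ℂ v ∧ Antitone b ∧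
      (∀ i, v i ∈ V) ∧ ∀ i j, star (v i).ofLp ⬝ᵥ (U.1 *ᵥ (v j).ofLp) =
        if i = j then Complex.I * (b j : ℂ) else 0 := by
  let H : Matrix (Fin n) (Fin n) ℂ := -Complex.I • U.1
  have hH : H.IsHermitian := by
    have := mem_LieU.1 U.2
    simp [Matrix.IsHermitian, H, this]
  have hUH : U.1 = Complex.I • H := by simp [H, smul_smul]
  let S := Matrix.toEuclideanLin H
  have hS : S.IsSymmetric := Matrix.isSymmetric_toEuclideanLin_iff.2 hH
  -- The compression of `H` to `V` is again symmetric; its eigenbasis is the required system.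
  let T : V →ₗ[ℂ] V := V.orthogonalProjectionOnto.toLinearMap ∘ₗ S ∘ₗ V.subtype
  have hTi : ∀ x y : V, ⟪x, T y⟫_ℂ = ⟪(x : EuclideanSpace ℂ (Fin n)), S y⟫_ℂ := fun x y =>
    Submodule.inner_orthogonalProjectionOnto_eq_of_mem_left x (S y)
  have hT : LinearMap.IsSymmetric (𝕜 := ℂ) (E := V) T := by
    intro x y
    rw [hTi, ← inner_conj_symm, hTi, inner_conj_symm]
    exact hS x y
  have hon := (hT.eigenvectorBasis hV).orthonormal
  refine ⟨fun i => hT.eigenvectorBasis hV i, hT.eigenvalues hV,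
    hon.comp_linearIsometry V.subtypeₗᵢ, hT.eigenvalues_antitone hV, fun i => SetLike.coe_mem _,
    fun i j => ?_⟩
  have h1 : star (hT.eigenvectorBasis hV i : EuclideanSpace ℂ (Fin n)).ofLp ⬝ᵥ
      (H *ᵥ (hT.eigenvectorBasis hV j : EuclideanSpace ℂ (Fin n)).ofLp) =
      ⟪(hT.eigenvectorBasis hV i : EuclideanSpace ℂ (Fin n)),
        S (hT.eigenvectorBasis hV j)⟫_ℂ := by
    rw [EuclideanSpace.inner_eq_star_dotProduct, dotProduct_comm]
    rfl
  rw [hUH, smul_mulVec, dotProduct_smul, h1, ← hTi, hT.apply_eigenvectorBasis, inner_smul_right,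
    orthonormal_iff_ite.1 hon i j]
  split_ifs <;> simp

/-- The element of the group given by an orthonormal basis and a translation. -/
theorem exists_group_of_orthonormal {v : Fin n → EuclideanSpace ℂ (Fin n)}
    (hv : Orthonormal ℂ v) (z : Fin n → ℂ) :
    ∃ g : G n, (∀ i j, g.mat i j = (v j).ofLp i) ∧ g.z = z := by
  let A : Matrix (Fin n) (Fin n) ℂ := of fun i j => (v j).ofLp i
  have hA : A ∈ unitaryGroup (Fin n) ℂ := by
    rw [mem_unitaryGroup_iff', star_eq_conjTranspose]
    ext i j
    rw [Matrix.mul_apply, one_apply, ← orthonormal_iff_ite.1 hv i j,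
      EuclideanSpace.inner_eq_star_dotProduct, dotProduct_comm]
    rfl
  exact ⟨⟨⟨A, hA⟩, z, 0⟩, fun i j => rfl, rfl⟩

theorem conj_apply_of_cols {g : G n} {v : Fin n → EuclideanSpace ℂ (Fin n)}
    (hg : ∀ i j, g.mat i j = (v j).ofLp i) (U : Matrix (Fin n) (Fin n) ℂ) (i j : Fin n) :
    (g.matᴴ * U * g.mat) i j = star (v i).ofLp ⬝ᵥ (U *ᵥ (v j).ofLp) := by
  have h1 : (fun k => g.mat k j) = (v j).ofLp := funext fun k => hg k j
  have h2 : (fun k => g.matᴴ i k) = star (v i).ofLp := by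
    funext k
    rw [conjTranspose_apply, hg]
    rfl
  rw [mul_assoc, Matrix.mul_apply, ← h1, ← h2]
  rfl

theorem eq_conj_of_conj_eq {g : G n} {U W : Matrix (Fin n) (Fin n) ℂ}
    (h : g.matᴴ * U * g.mat = W) : U = g.mat * W * g.matᴴ := by
  have hm := mat_mul_conj g
  rw [← h]
  calc U = (g.mat * g.matᴴ) * U * (g.mat * g.matᴴ) := by rw [hm, one_mul, mul_one]
    _ = _ := by simp only [mul_assoc]

/-- Normal form of a linear form with nonzero central character. -/
theorem exists_normalForm_of_ne_zero (l : LieGDual n) (hx : l.2.2 ≠ 0) :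
    ∃ (b : Fin n → ℝ) (g : G n), Antitone b ∧ l = g • ((J b, 0, l.2.2) : LieGDual n) := by
  -- Translation of a form with zero vector part yields `xz` and `(x/2) z × z`, so `z = u/x` and the
  -- remainder `M` is diagonalised.
  let z : Fin n → ℂ := ((l.2.2)⁻¹ : ℝ) • l.2.1
  let M : LieU n := l.1 - (l.2.2 / 2) • ⟨cross z z, cross_mem z z⟩
  obtain ⟨v, b, hv, hb, -, hvb⟩ := exists_orthonormal_diagonalizing (p := n) M ⊤ (by simp)
  obtain ⟨g, hg, hgz⟩ := exists_group_of_orthonormal hv z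
  refine ⟨b, g, hb, Prod.ext (Subtype.ext ?_) (Prod.ext ?_ rfl)⟩
  · have hM : M.1 = g.mat * (J b).1 * g.matᴴ := by
      refine eq_conj_of_conj_eq ?_
      ext i j
      rw [conj_apply_of_cols hg, hvb]
      by_cases hij : i = j
      · simp [J, hij]
      · simp [J, hij]
    rw [smul_fst]
    simp only
    rw [← hM, hgz]
    simp [M, cross]
  · rw [smul_snd, hgz]
    ext i
    simp [z, hx]

/-- Normal form of a linear form with zero central character and nonzero vector component. -/
theorem exists_normalForm_of_eq_zero {m : ℕ} (U : LieU (m + 1)) {u : Fin (m + 1) → ℂ}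
    (hu : u ≠ 0) :
    ∃ (b : Fin m → ℝ) (r : ℝ) (g : G (m + 1)), Antitone b ∧ 0 < r ∧
      ((U, u, 0) : LieGDual (m + 1)) = g • ((J (Fin.snoc (α := fun _ => ℝ) b 0),
        Pi.single (Fin.last m) (r : ℂ), 0) : LieGDual (m + 1)) := by
  let w : EuclideanSpace ℂ (Fin (m + 1)) := WithLp.toLp 2 u
  have hw : w ≠ 0 := fun h => hu (congrArg WithLp.ofLp h)
  let r : ℝ := ‖w‖
  have hr : 0 < r := norm_pos_iff.2 hw
  have hrC : (r : ℂ) ≠ 0 := by exact_mod_cast hr.ne'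
  have : Fact (Module.finrank ℂ (EuclideanSpace ℂ (Fin (m + 1))) = m + 1) := ⟨by simp⟩
  -- Only the compression to the complement of `u` can be diagonalised; translations absorb the last
  -- row and column.
  obtain ⟨v, b, hv, hb, hvV, hvb⟩ := exists_orthonormal_diagonalizing U (Submodule.span ℂ {w})ᗮ
    (Submodule.finrank_orthogonal_span_singleton (n := m) hw)
  let c : Fin (m + 1) → EuclideanSpace ℂ (Fin (m + 1)) :=
    Fin.snoc (α := fun _ => EuclideanSpace ℂ (Fin (m + 1))) v ((r : ℂ)⁻¹ • w)
  have hvw : ∀ i, ⟪w, v i⟫_ℂ = 0 := fun i =>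
    Submodule.mem_orthogonal_singleton_iff_inner_right.1 (hvV i)
  have hc : Orthonormal ℂ c := by
    constructor
    · intro i
      induction i using Fin.lastCases with
      | last => simp [c, norm_smul, r, hw]
      | cast i => simpa [c] using hv.1 i
    · intro i j hij
      induction i using Fin.lastCases with
      | last =>
        induction j using Fin.lastCases with
        | last => exact absurd rfl hij
        | cast j => simp [c, inner_smul_left, hvw]
      | cast i =>
        induction j using Fin.lastCases with
        | last => simp [c, inner_smul_right, inner_eq_zero_symm.1 (hvw i)]
        | cast j => simpa [c] using hv.2 (fun h => hij (by rw [h]))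
  obtain ⟨g₀, hg₀, -⟩ := exists_group_of_orthonormal hc 0
  let W : Matrix (Fin (m + 1)) (Fin (m + 1)) ℂ := g₀.matᴴ * U.1 * g₀.mat
  have hWskew : ∀ i j, star (W i j) = -W j i := by
    intro i j
    have : Wᴴ = -W := by
      have h := mem_LieU.1 U.2
      simp [W, conjTranspose_mul, h, mul_assoc]
    have := congrFun (congrFun this j) i
    simpa using this
  have hWb : ∀ i j : Fin m, W i.castSucc j.castSucc = if i = j then Complex.I * (b j : ℂ) else 0 := by
    intro i j
    rw [← hvb]
    refine (conj_apply_of_cols hg₀ _ _ _).trans ?_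
    simp [c]
  -- Solution of `y × e = W` in the last row and column, where `e = r e_n`. The last entry is halved
  -- because both summands of `y × e` contribute to the corner; it is real since `W` is
  -- skew-Hermitian.
  let y : Fin (m + 1) → ℂ := Fin.snoc (α := fun _ => ℂ)
    (fun i => -2 * Complex.I * W i.castSucc (Fin.last m) / r)
    (-Complex.I * W (Fin.last m) (Fin.last m) / r)
  let e : Fin (m + 1) → ℂ := Pi.single (Fin.last m) (r : ℂ)
  have hWJ : W = (J (Fin.snoc (α := fun _ => ℝ) b 0)).1 + cross y e := by
    have hI := Complex.I_mul_I
    ext i j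
    simp only [cross, Matrix.add_apply, Matrix.smul_apply, vecMulVec_apply, smul_eq_mul,
      Pi.star_apply]
    induction i using Fin.lastCases with
    | last =>
      induction j using Fin.lastCases with
      | last =>
        have h := hWskew (Fin.last m) (Fin.last m)
        simp only [J, diagonal_apply_eq, Fin.snoc_last, e, y, Pi.single_eq_same, star_div₀,
          star_mul', star_neg, h]
        simp
        field_simp
        linear_combination (2 * W (Fin.last m) (Fin.last m)) * hI
      | cast j =>
        have h := hWskew j.castSucc (Fin.last m)
        simp only [J, e, y, Fin.snoc_castSucc, Pi.single_eq_same, star_div₀,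
          star_mul', star_neg, h]
        simp [(Fin.castSucc_ne_last j).symm]
        field_simp
        linear_combination (W (Fin.last m) j.castSucc) * hI
    | cast i =>
      induction j using Fin.lastCases with
      | last =>
        simp only [J, e, y, Fin.snoc_castSucc, Pi.single_eq_same]
        simp [Fin.castSucc_ne_last]
        field_simp
        linear_combination (W i.castSucc (Fin.last m)) * hI
      | cast j =>
        rw [hWb]
        by_cases hij : i = j
        · simp [J, hij, e, Fin.castSucc_ne_last]
        · simp [J, hij, e, Fin.castSucc_ne_last]
  refine ⟨b, r, ⟨g₀.A, g₀.mat *ᵥ y, 0⟩, hb, hr, ?_⟩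
  have hge : g₀.mat *ᵥ e = u := by
    ext i
    simp [e, hg₀, c, w]
    field_simp
  refine Prod.ext (Subtype.ext ?_) (Prod.ext ?_ rfl)
  · rw [smul_fst]
    have h1 : U.1 = g₀.mat * W * g₀.matᴴ := eq_conj_of_conj_eq rfl
    change U.1 = g₀.mat * _ * g₀.matᴴ + cross (g₀.mat *ᵥ y) (g₀.mat *ᵥ e) + _
    rw [h1, hWJ, mul_add, add_mul, conj_cross]
    simp
  · rw [smul_snd]
    change u = g₀.mat *ᵥ e + _
    simp [hge]

end NormalForm

/-! ### Orbits are determined by their invariants -/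

section Recognition

open Polynomial in
-- Equality at all real `t` is equality of polynomials; compare leading coefficients and roots.
theorem prod_eq_prod {n : ℕ} {a b : Fin n → ℝ} {c d : ℝ} (hd : d ≠ 0)
    (h : ∀ t : ℝ, c * ∏ i, (t - a i) = d * ∏ i, (t - b i)) :
    c = d ∧ Finset.univ.val.map a = Finset.univ.val.map b := by
  have hp : C c * ∏ i, (X - C (a i)) = C d * ∏ i, (X - C (b i)) := by
    refine Polynomial.funext fun t => ?_
    simpa [eval_prod] using h t
  have hcd : c = d := by
    have := congrArg leadingCoeff hp
    have hm : ∀ f : Fin n → ℝ, (∏ i, (X - C (f i))).leadingCoeff = 1 := fun f =>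
      (monic_prod_of_monic _ _ fun i _ => monic_X_sub_C (f i)).leadingCoeff
    simpa [leadingCoeff_mul, hm] using this
  subst hcd
  refine ⟨rfl, ?_⟩
  have hr := congrArg roots hp
  rw [roots_C_mul _ hd, roots_C_mul _ hd] at hr
  rw [← Polynomial.roots_multiset_prod_X_sub_C (Finset.univ.val.map a),
    ← Polynomial.roots_multiset_prod_X_sub_C (Finset.univ.val.map b), Multiset.map_map,
    Multiset.map_map]
  exact hr

theorem antitone_cast {n : ℕ} (l : Weight n) : Antitone fun j => (l.1 j : ℝ) :=
  fun _ _ h => Int.cast_le.2 (l.2 h)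

/-- The invariants determine the orbits with nonzero central character. -/
theorem mem_orbit_ellGen {n : ℕ} {l : Weight n} {a : ℝ} (ha : a ≠ 0) {U : LieU n}
    {u : Fin n → ℂ} (h : ∀ t : ℝ, detInv t ((U, u, a) : LieGDual n) =
      ((2 * a * ∏ i, (t - (l.1 i : ℝ)) : ℝ) : ℂ)) :
    ((U, u, a) : LieGDual n) ∈ MulAction.orbit (G n) (ellGen l a) := by
  obtain ⟨b, g, hb, hg⟩ := exists_normalForm_of_ne_zero ((U, u, a) : LieGDual n) ha
  have hab : ∀ t : ℝ, 2 * a * ∏ i, (t - b i) = 2 * a * ∏ i, (t - (l.1 i : ℝ)) := by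
    intro t
    have h1 := h t
    rw [hg, detInv_smul, detInv_diagonal] at h1
    simpa using Complex.ofReal_injective h1
  have := antitone_eq_of_map_eq hb (antitone_cast l)
    (prod_eq_prod (mul_ne_zero two_ne_zero ha) hab).2
  exact ⟨g, by simpa [ellGen, ← this] using hg.symm⟩

/-- The invariants determine the orbits with zero central character and nonzero vector
component. -/
theorem mem_orbit_ellMid {m : ℕ} {mu : Weight m} {r : ℝ} (hr : 0 < r) {U : LieU (m + 1)}
    {u : Fin (m + 1) → ℂ} (h : ∀ t : ℝ, detInv t ((U, u, 0) : LieGDual (m + 1)) =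
      ((r ^ 2 * ∏ i, (t - (mu.1 i : ℝ)) : ℝ) : ℂ)) :
    ((U, u, 0) : LieGDual (m + 1)) ∈ MulAction.orbit (G (m + 1)) (ellMid mu r) := by
  have hu : u ≠ 0 := by
    rintro rfl
    -- With `u = 0` and `x = 0` the last row of the bordered matrix is zero, which would force `r² =
    -- 0`.
    have h0 : ∀ t : ℝ, 0 * ∏ i, (t - (mu.1 i : ℝ)) = r ^ 2 * ∏ i, (t - (mu.1 i : ℝ)) := by
      intro t
      have hz : (bordered t ((U, 0, 0) : LieGDual (m + 1))).det = 0 :=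
        det_eq_zero_of_row_eq_zero (Sum.inr ()) (by rintro (j | j) <;> simp [bordered])
      have h1 := h t
      rw [detInv, hz, neg_zero] at h1
      rw [zero_mul]
      exact Complex.ofReal_injective (by simpa using h1)
    exact pow_ne_zero 2 hr.ne' (prod_eq_prod (pow_ne_zero 2 hr.ne') h0).1.symm
  obtain ⟨b, s, g, hb, hs, hg⟩ := exists_normalForm_of_eq_zero U hu
  have hab : ∀ t : ℝ, s ^ 2 * ∏ i, (t - b i) = r ^ 2 * ∏ i, (t - (mu.1 i : ℝ)) := by
    intro t
    have h1 := h t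
    rw [hg, detInv_smul, detInv_snoc_single] at h1
    simpa using Complex.ofReal_injective h1
  obtain ⟨h1, h2⟩ := prod_eq_prod (pow_ne_zero 2 hr.ne') hab
  have hsr : s = r := (pow_left_inj₀ hs.le hr.le two_ne_zero).1 h1
  have := antitone_eq_of_map_eq hb (antitone_cast mu) h2
  exact ⟨g, by simpa [ellMid, ← this, ← hsr] using hg.symm⟩

end Recognition

/-! ### Nonnegative weights from interlacing -/

section Weights

variable {n : ℕ}

/-- The polynomial function `∑ i, p i * ∏ j ≠ i, (t - l j)`. -/
def weightedSum (p l : Fin n → ℝ) (t : ℝ) : ℝ :=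
  ∑ i, p i * ∏ j ∈ Finset.univ.erase i, (t - l j)

/-- Compactness: evaluation at one large `T` bounds all the weights, so a subsequence converges, and
nonnegativity and the identity survive the limit. -/
theorem exists_weights_of_tendsto {ls : ℕ → Fin n → ℝ} {l : Fin n → ℝ}
    (hl : ∀ i, Tendsto (fun k => ls k i) atTop (𝓝 (l i))) {R : ℕ → ℝ → ℝ} {R₀ : ℝ → ℝ}
    (hR : ∀ t, Tendsto (fun k => R k t) atTop (𝓝 (R₀ t)))
    (h : ∀ k, ∃ p : Fin n → ℝ, (∀ i, 0 ≤ p i) ∧ ∀ t, weightedSum p (ls k) t = R k t) :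
    ∃ p : Fin n → ℝ, (∀ i, 0 ≤ p i) ∧ ∀ t, weightedSum p l t = R₀ t := by
  choose p hp hpR using h
  -- Beyond `l i + 1` all factors are eventually at least 1, so each weight is at most the whole sum
  -- at `T`.
  obtain ⟨T, hT⟩ : ∃ T : ℝ, ∀ i, l i + 1 < T := by
    obtain ⟨T, hT⟩ := (Set.finite_range fun i => l i + 1).bddAbove
    exact ⟨T + 1, fun i => by linarith [hT (Set.mem_range_self i)]⟩
  have hev1 : ∀ᶠ k in atTop, ∀ i, ls k i + 1 < T :=
    eventually_all.2 fun i => ((hl i).add_const 1).eventually_lt_const (hT i)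
  have hev2 : ∀ᶠ k in atTop, R k T < R₀ T + 1 := (hR T).eventually_lt_const (by linarith)
  have hmem : ∀ᶠ k in atTop, p k ∈ Set.pi Set.univ fun _ : Fin n => Set.Icc 0 (R₀ T + 1) := by
    filter_upwards [hev1, hev2] with k h1 h2 i _
    refine ⟨hp k i, ?_⟩
    have hprod : ∀ i, 1 ≤ ∏ j ∈ Finset.univ.erase i, (T - ls k j) := fun i =>
      Finset.one_le_prod fun j _ => by linarith [h1 j]
    calc p k i ≤ p k i * ∏ j ∈ Finset.univ.erase i, (T - ls k j) :=
          le_mul_of_one_le_right (hp k i) (hprod i)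
      _ ≤ weightedSum (p k) (ls k) T :=
          Finset.single_le_sum (f := fun i => p k i * ∏ j ∈ Finset.univ.erase i, (T - ls k j))
            (fun i _ => mul_nonneg (hp k i) (zero_le_one.trans (hprod i))) (Finset.mem_univ i)
      _ ≤ R₀ T + 1 := by rw [hpR]; exact h2.le
  obtain ⟨q, -, φ, hφ, hq⟩ :=
    (isCompact_univ_pi fun _ => isCompact_Icc).tendsto_subseq' hmem.frequently
  have hqi : ∀ i, Tendsto (fun k => p (φ k) i) atTop (𝓝 (q i)) := tendsto_pi_nhds.1 hq
  refine ⟨q, fun i => ge_of_tendsto' (hqi i) fun k => hp _ i, fun t => ?_⟩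
  have h1 : Tendsto (fun k => weightedSum (p (φ k)) (ls (φ k)) t) atTop
      (𝓝 (weightedSum q l t)) :=
    tendsto_finsetSum _ fun i _ => (hqi i).mul (tendsto_finsetProd _ fun j _ =>
      ((hl j).comp hφ.tendsto_atTop).const_sub t)
  have h2 : Tendsto (fun k => weightedSum (p (φ k)) (ls (φ k)) t) atTop (𝓝 (R₀ t)) := by
    simp only [hpR]
    exact (hR t).comp hφ.tendsto_atTop
  exact tendsto_nhds_unique h1 h2

open Polynomial in
-- The difference of two monic polynomials of equal degree is its own Lagrange interpolant at the
-- nodes `l_i`. This gives `p_i = c (l_i - a_i) ∏_{j≠i} (l_i - a_j)/(l_i - l_j)`, and interlacing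
-- makes every quotient nonnegative.
theorem exists_weights_of_strictAnti {m : ℕ} {l a : Fin (m + 1) → ℝ} {c : ℝ} (hl : StrictAnti l)
    (h0 : ∀ i, 0 ≤ c * (l i - a i)) (h1 : ∀ i j, j < i → l i ≤ a j)
    (h2 : ∀ i j, i < j → a j ≤ l i) :
    ∃ p : Fin (m + 1) → ℝ, (∀ i, 0 ≤ p i) ∧
      ∀ t, weightedSum p l t = c * ∏ i, (t - a i) - c * ∏ i, (t - l i) := by
  have hmonic : ∀ f : Fin (m + 1) → ℝ, (∏ i, (X - C (f i))).Monic := fun f =>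
    monic_prod_of_monic _ _ fun i _ => monic_X_sub_C (f i)
  have hdeg : ∀ f : Fin (m + 1) → ℝ, (∏ i, (X - C (f i))).degree = ((m + 1 : ℕ) : WithBot ℕ) :=
    fun f => by simp [degree_prod]
  let R : ℝ[X] := ∏ i, (X - C (a i)) - ∏ i, (X - C (l i))
  have hR : R.degree < (Finset.univ : Finset (Fin (m + 1))).card := by
    have := degree_sub_lt_left ((hdeg a).trans (hdeg l).symm) (hmonic a).ne_zero
      ((hmonic a).trans (hmonic l).symm)
    rw [hdeg] at this
    simpa using this
  have hint := Lagrange.eq_interpolate (s := Finset.univ) (v := l) hl.injective.injOn hR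
  have hRl : ∀ i, eval (l i) R = ∏ j, (l i - a j) := by
    intro i
    have : ∏ j, (l i - l j) = 0 := Finset.prod_eq_zero (Finset.mem_univ i) (sub_self _)
    simp [R, eval_prod, this]
  refine ⟨fun i => c * eval (l i) R * ∏ j ∈ Finset.univ.erase i, (l i - l j)⁻¹, fun i => ?_,
    fun t => ?_⟩
  · simp only
    rw [hRl, ← Finset.mul_prod_erase _ _ (Finset.mem_univ i), ← mul_assoc, mul_assoc,
      ← Finset.prod_mul_distrib]
    refine mul_nonneg (h0 i) (Finset.prod_nonneg fun j hj => ?_)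
    rcases lt_or_gt_of_ne (Finset.ne_of_mem_erase hj) with hji | hij
    · exact mul_nonneg_of_nonpos_of_nonpos (sub_nonpos.2 (h1 i j hji))
        (inv_nonpos.2 (sub_nonpos.2 (hl hji).le))
    · exact mul_nonneg (sub_nonneg.2 (h2 i j hij)) (inv_nonneg.2 (sub_nonneg.2 (hl hij).le))
  · have h3 := congrArg (eval t) hint
    rw [Lagrange.interpolate_apply, eval_finsetSum] at h3
    have h4 : eval t R = ∏ i, (t - a i) - ∏ i, (t - l i) := by simp [R, eval_prod]
    rw [h4] at h3
    rw [← mul_sub, h3, weightedSum, Finset.mul_sum]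
    refine Finset.sum_congr rfl fun i _ => ?_
    simp only [Lagrange.basis, Lagrange.basisDivisor, eval_mul, eval_C, eval_prod, eval_sub,
      eval_X, Finset.prod_mul_distrib]
    ring

/-- Inverse interlacing for rank one perturbations. -/
theorem exists_weights {m : ℕ} {l a : Fin (m + 1) → ℝ} {c : ℝ} (hl : Antitone l)
    (h0 : ∀ i, 0 ≤ c * (l i - a i)) (h1 : ∀ i j, j < i → l i ≤ a j)
    (h2 : ∀ i j, i < j → a j ≤ l i) :
    ∃ p : Fin (m + 1) → ℝ, (∀ i, 0 ≤ p i) ∧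
      ∀ t, weightedSum p l t = c * ∏ i, (t - a i) - c * ∏ i, (t - l i) := by
  -- Lowering the `i`-th entries of both `l` and `a` by `i e_k` separates the nodes, keeps `l_i -
  -- a_i` and preserves the other inequalities.
  let e : ℕ → ℝ := fun k => 1 / ((k : ℝ) + 1)
  have he : ∀ k, 0 < e k := fun k => by positivity
  have hshift : ∀ (f : Fin (m + 1) → ℝ) (i : Fin (m + 1)),
      Tendsto (fun k => f i - (i : ℝ) * e k) atTop (𝓝 (f i)) := by
    intro f i
    have := ((tendsto_one_div_add_atTop_nhds_zero_nat (𝕜 := ℝ)).const_mul (i : ℝ)).const_sub (f i)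
    simpa [e] using this
  have hlt : ∀ {i j : Fin (m + 1)} (k : ℕ), i < j → (i : ℝ) * e k < (j : ℝ) * e k := by
    intro i j k hij
    exact mul_lt_mul_of_pos_right (by exact_mod_cast hij) (he k)
  refine exists_weights_of_tendsto (hshift l)
    (R := fun k t => c * ∏ i, (t - (a i - (i : ℝ) * e k)) - c * ∏ i, (t - (l i - (i : ℝ) * e k)))
    (fun t => ?_) fun k => exists_weights_of_strictAnti ?_ ?_ ?_ ?_
  · exact ((tendsto_finsetProd _ fun i _ => (hshift a i).const_sub t).const_mul c).sub
      ((tendsto_finsetProd _ fun i _ => (hshift l i).const_sub t).const_mul c)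
  · intro i j hij
    have := hl hij.le
    have := hlt k hij
    simp only
    linarith
  · intro i
    have := h0 i
    rwa [sub_sub_sub_cancel_right]
  · intro i j hji
    have := hlt k hji
    linarith [h1 i j hji]
  · intro i j hij
    have := hlt k hij
    linarith [h2 i j hij]

/-- Inverse interlacing for compressions to a hyperplane. -/
theorem exists_weights_compression {m : ℕ} {l : Fin (m + 1) → ℝ} {a : Fin m → ℝ} (hl : Antitone l)
    (h1 : ∀ j : Fin m, a j ≤ l j.castSucc) (h2 : ∀ j : Fin m, l j.succ ≤ a j) :
    ∃ p : Fin (m + 1) → ℝ, (∀ i, 0 ≤ p i) ∧ ∀ t, weightedSum p l t = ∏ i, (t - a i) := by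
  -- Adjoin to `a` a root `-N_k` that tends to `-∞` and scale by `1/N_k`: the extra factor `(t +
  -- N_k)/N_k` tends to 1, and the subtracted product disappears.
  let N : ℕ → ℝ := fun k => (|l (Fin.last m)| + 1) + k
  have hN0 : ∀ k, 0 < N k := fun k => by positivity
  have hNl : ∀ k i, -N k ≤ l i := fun k i => by
    have h3 := neg_abs_le (l (Fin.last m))
    have h4 := hl (Fin.le_last i)
    have h5 : (0 : ℝ) ≤ k := k.cast_nonneg
    simp only [N]
    linarith
  have hN : Tendsto (fun k => (N k)⁻¹) atTop (𝓝 0) :=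
    (tendsto_atTop_add_const_left _ _ tendsto_natCast_atTop_atTop).inv_tendsto_atTop
  let A : ℕ → Fin (m + 1) → ℝ := fun k => Fin.snoc (α := fun _ => ℝ) a (-N k)
  refine exists_weights_of_tendsto (ls := fun _ => l) (fun i => tendsto_const_nhds)
    (R := fun k t => (N k)⁻¹ * ∏ i, (t - A k i) - (N k)⁻¹ * ∏ i, (t - l i))
    (fun t => ?_) fun k => exists_weights hl ?_ ?_ ?_
  · have h3 : ∀ k, (N k)⁻¹ * ∏ i, (t - A k i) - (N k)⁻¹ * ∏ i, (t - l i) =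
        ∏ i, (t - a i) + (N k)⁻¹ * (t * ∏ i, (t - a i) - ∏ i, (t - l i)) := by
      intro k
      have := (hN0 k).ne'
      rw [Fin.prod_univ_castSucc]
      simp only [A, Fin.snoc_castSucc, Fin.snoc_last]
      field_simp
      ring
    simp only [h3]
    simpa using (hN.mul_const (t * ∏ i, (t - a i) - ∏ i, (t - l i))).const_add (∏ i, (t - a i))
  · intro i
    refine mul_nonneg (inv_nonneg.2 (hN0 k).le) (sub_nonneg.2 ?_)
    induction i using Fin.lastCases with
    | last => simpa [A] using hNl k (Fin.last m)
    | cast i => simpa [A] using h1 i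
  · intro i j hji
    induction j using Fin.lastCases with
    | last => exact absurd hji (not_lt.2 (Fin.le_last i))
    | cast j =>
      have h3 := hl (Fin.castSucc_lt_iff_succ_le.1 hji)
      simpa [A] using h3.trans (h2 j)
  · intro i j hij
    induction j using Fin.lastCases with
    | last => simpa [A] using hNl k i
    | cast j => simpa [A] using (h1 j).trans (hl hij.le)

end Weights

/-! ### Orbit points over a prescribed diagonal matrix -/

section InverseInterlacing

variable {m : ℕ}

theorem exists_norm_sq {n : ℕ} {p : Fin n → ℝ} (hp : ∀ i, 0 ≤ p i) :
    ∃ u : Fin n → ℂ, ∀ i, ‖u i‖ ^ 2 = p i :=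
  ⟨fun i => (Real.sqrt (p i) : ℂ), fun i => by simp [Real.sq_sqrt (hp i)]⟩

/-- Choosing `|u_i|²` as the interlacing weights gives the point the `detInv` of the orbit, hence
membership; the norm of `u` is then read off from `traceInv`. -/
theorem exists_mem_orbit_ellGen {l b : Weight (m + 1)} {a : ℝ} (ha : a ≠ 0)
    (h : (0 < a ∧ Interlace l b) ∨ (a < 0 ∧ Interlace b l)) :
    ∃ u : Fin (m + 1) → ℂ, ((J fun j => (l.1 j : ℝ), u, a) : LieGDual (m + 1)) ∈
      MulAction.orbit (G (m + 1)) (ellGen b a) ∧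
      ∑ i, ‖u i‖ ^ 2 = 2 * a * (∑ i, (l.1 i : ℝ) - ∑ i, (b.1 i : ℝ)) := by
  have hw : ∃ p : Fin (m + 1) → ℝ, (∀ i, 0 ≤ p i) ∧ ∀ t, weightedSum p (fun j => (l.1 j : ℝ)) t =
      2 * a * ∏ i, (t - (b.1 i : ℝ)) - 2 * a * ∏ i, (t - (l.1 i : ℝ)) := by
    refine exists_weights (antitone_cast l) (fun i => ?_) (fun i j hji => ?_) (fun i j hij => ?_)
    · rcases h with ⟨ha, h⟩ | ⟨ha, h⟩
      · have : (b.1 i : ℝ) ≤ l.1 i := by exact_mod_cast h.1 i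
        exact mul_nonneg (by linarith) (by linarith)
      · have : (l.1 i : ℝ) ≤ b.1 i := by exact_mod_cast h.1 i
        exact mul_nonneg_of_nonpos_of_nonpos (by linarith) (by linarith)
    · have : l.1 i ≤ b.1 j := by
        rcases h with ⟨ha, h⟩ | ⟨ha, h⟩
        · induction j using Fin.lastCases with
          | last => exact absurd hji (not_lt.2 (Fin.le_last i))
          | cast j => exact (l.2 (Fin.castSucc_lt_iff_succ_le.1 hji)).trans (h.2 j)
        · exact (l.2 hji.le).trans (h.1 j)
      exact_mod_cast this
    · have : b.1 j ≤ l.1 i := by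
        rcases h with ⟨ha, h⟩ | ⟨ha, h⟩
        · exact (h.1 j).trans (l.2 hij.le)
        · induction i using Fin.lastCases with
          | last => exact absurd hij (not_lt.2 (Fin.le_last j))
          | cast i => exact (b.2 (Fin.castSucc_lt_iff_succ_le.1 hij)).trans (h.2 i)
      exact_mod_cast this
  obtain ⟨p, hp, hpt⟩ := hw
  obtain ⟨u, hu⟩ := exists_norm_sq hp
  have hmem : ((J fun j => (l.1 j : ℝ), u, a) : LieGDual (m + 1)) ∈
      MulAction.orbit (G (m + 1)) (ellGen b a) := by
    refine mem_orbit_ellGen ha fun t => ?_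
    rw [detInv_diagonal]
    have := hpt t
    rw [weightedSum] at this
    simp only [hu, this]
    congr 1
    ring
  refine ⟨u, hmem, ?_⟩
  obtain ⟨g, hg⟩ := hmem
  have h1 := traceInv_smul g (ellGen b a)
  simp only at hg
  rw [hg, ellGen, traceInv_diagonal, traceInv_diagonal] at h1
  simp at h1
  linarith

theorem exists_mem_orbit_ellMid {l : Weight (m + 1)} {mu : Weight m} {r : ℝ} (hr : 0 < r)
    (h : InterlaceShort l mu) :
    ∃ u : Fin (m + 1) → ℂ, ((J fun j => (l.1 j : ℝ), u, 0) : LieGDual (m + 1)) ∈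
      MulAction.orbit (G (m + 1)) (ellMid mu r) ∧ ∑ i, ‖u i‖ ^ 2 = r ^ 2 := by
  obtain ⟨p, hp, hpt⟩ := exists_weights_compression (antitone_cast l)
    (a := fun j => (mu.1 j : ℝ)) (fun j => by exact_mod_cast (h j).1)
    (fun j => by exact_mod_cast (h j).2)
  obtain ⟨u, hu⟩ := exists_norm_sq (p := fun i => r ^ 2 * p i)
    (fun i => mul_nonneg (sq_nonneg r) (hp i))
  have hmem : ((J fun j => (l.1 j : ℝ), u, 0) : LieGDual (m + 1)) ∈
      MulAction.orbit (G (m + 1)) (ellMid mu r) := by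
    refine mem_orbit_ellMid hr fun t => ?_
    rw [detInv_diagonal]
    have := hpt t
    rw [weightedSum] at this
    simp only [hu, mul_assoc (r ^ 2), ← Finset.mul_sum, this]
    simp
  refine ⟨u, hmem, ?_⟩
  obtain ⟨g, hg⟩ := hmem
  have h1 := traceInv_smul g (ellMid mu r)
  simp only at hg
  rw [hg, ellMid, traceInv_diagonal, traceInv_single] at h1
  simpa using h1

end InverseInterlacing

/-! ### The convergence criteria -/

section Limits

variable {m : ℕ}

theorem detInv_ellGen {n : ℕ} (t : ℝ) (l : Weight n) (a : ℝ) :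
    detInv t (ellGen l a) = ((2 * a * ∏ i, (t - (l.1 i : ℝ)) : ℝ) : ℂ) := by
  rw [ellGen, detInv_diagonal]
  simp

theorem detInv_ellMid (t : ℝ) (mu : Weight m) (r : ℝ) :
    detInv t (ellMid mu r) = ((r ^ 2 * ∏ i, (t - (mu.1 i : ℝ)) : ℝ) : ℂ) := by
  rw [ellMid, detInv_snoc_single]
  simp

theorem traceInv_ellGen {n : ℕ} (l : Weight n) (a : ℝ) :
    traceInv (ellGen l a) = -(2 * a * ∑ i, (l.1 i : ℝ)) := by
  rw [ellGen, traceInv_diagonal]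
  simp

theorem traceInv_ellMid (mu : Weight m) (r : ℝ) : traceInv (ellMid mu r) = r ^ 2 := by
  rw [ellMid, traceInv_single]

theorem traceInv_ellU {n : ℕ} (l : Weight n) : traceInv (ellU l) = 0 := by
  rw [ellU, traceInv_diagonal]
  simp

section Invariants

variable {x : ℕ → admissible m} {y : admissible m}

theorem tendsto_central
    (h : Tendsto (fun k => (Quotient.mk _ (x k) : OrbitSpace m)) atTop (𝓝 (Quotient.mk _ y))) :
    Tendsto (fun k => (x k : LieGDual (m + 1)).2.2) atTop (𝓝 (y : LieGDual (m + 1)).2.2) :=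
  tendsto_invariant (continuous_snd.comp continuous_snd) smul_trd h

theorem tendsto_traceInv
    (h : Tendsto (fun k => (Quotient.mk _ (x k) : OrbitSpace m)) atTop (𝓝 (Quotient.mk _ y))) :
    Tendsto (fun k => traceInv (x k : LieGDual (m + 1))) atTop
      (𝓝 (traceInv (y : LieGDual (m + 1)))) :=
  tendsto_invariant continuous_traceInv traceInv_smul h

theorem tendsto_detInv (t : ℝ)
    (h : Tendsto (fun k => (Quotient.mk _ (x k) : OrbitSpace m)) atTop (𝓝 (Quotient.mk _ y))) :
    Tendsto (fun k => (detInv t (x k : LieGDual (m + 1))).re) atTop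
      (𝓝 (detInv t (y : LieGDual (m + 1))).re) :=
  (Complex.continuous_re.tendsto _).comp (tendsto_invariant (continuous_detInv t) (detInv_smul t) h)

/-- Substitute for `detInv`, which is identically zero at the limit `O_λ`: here only the
`U`-component near `J_λ` is used. -/
theorem eventually_formClose {l : Weight (m + 1)}
    (h : Tendsto (fun k => (Quotient.mk _ (x k) : OrbitSpace m)) atTop (𝓝 (orbU l))) :
    ∀ᶠ k in atTop, ∃ g : G (m + 1),
      FormClose (hForm (g • (x k : LieGDual (m + 1))).1.1) l.1 :=
  (tendsto_orbit_iff x ⟨ellU l, ellU_mem l⟩).1 h _ (formClose_eventually l.1 (ellU l) rfl)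

end Invariants

theorem continuous_ellGen {n : ℕ} (l : Weight n) : Continuous fun a : ℝ => ellGen l a := by
  unfold ellGen
  fun_prop

theorem continuous_ellMid (mu : Weight m) : Continuous fun r : ℝ => ellMid mu r := by
  have : Continuous fun r : ℝ => (Pi.single (Fin.last m) (r : ℂ) : Fin (m + 1) → ℂ) :=
    (continuous_single _).comp Complex.continuous_ofReal
  unfold ellMid
  fun_prop

theorem tendsto_orbGen_orbGen (L : ℕ → Weight (m + 1)) (a : ℕ → {a : ℝ // a ≠ 0})
    (l : Weight (m + 1)) (a₀ : {a : ℝ // a ≠ 0}) :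
    Tendsto (fun k => orbGen (L k) (a k)) atTop (𝓝 (orbGen l a₀)) ↔
      Tendsto (fun k => (a k : ℝ)) atTop (𝓝 (a₀ : ℝ)) ∧ ∀ᶠ k in atTop, L k = l := by
  constructor
  · intro h
    refine ⟨tendsto_central h, eventually_eq_of_tendsto
      (c := fun k => 2 * (a k : ℝ)) (mul_ne_zero two_ne_zero a₀.2) fun t => ?_⟩
    have := tendsto_detInv t h
    simpa only [detInv_ellGen, Complex.ofReal_re] using this
  · rintro ⟨ha, hL⟩
    refine tendsto_orbit_of_tendsto (fun k => ellGen l (a k)) ?_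
      (((continuous_ellGen l).tendsto _).comp ha)
    filter_upwards [hL] with k hk
    rw [← hk]
    exact MulAction.mem_orbit_self _

theorem tendsto_orbMid_orbMid (M : ℕ → Weight m) (R : ℕ → {r : ℝ // 0 < r}) (mu : Weight m)
    (r : {r : ℝ // 0 < r}) :
    Tendsto (fun k => orbMid (M k) (R k)) atTop (𝓝 (orbMid mu r)) ↔
      Tendsto (fun k => (R k : ℝ)) atTop (𝓝 (r : ℝ)) ∧ ∀ᶠ k in atTop, M k = mu := by
  constructor
  · intro h
    constructor
    · have h1 := tendsto_traceInv h
      simp only [traceInv_ellMid] at h1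
      have h2 := (Real.continuous_sqrt.tendsto _).comp h1
      rw [Real.sqrt_sq r.2.le] at h2
      exact h2.congr fun k => Real.sqrt_sq (R k).2.le
    · refine eventually_eq_of_tendsto (c := fun k => (R k : ℝ) ^ 2) (pow_ne_zero 2 r.2.ne')
        fun t => ?_
      have := tendsto_detInv t h
      simpa only [detInv_ellMid, Complex.ofReal_re] using this
  · rintro ⟨hR, hM⟩
    refine tendsto_orbit_of_tendsto (fun k => ellMid mu (R k)) ?_
      (((continuous_ellMid mu).tendsto _).comp hR)
    filter_upwards [hM] with k hk
    rw [← hk]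
    exact MulAction.mem_orbit_self _

theorem tendsto_orbU_orbU (L : ℕ → Weight (m + 1)) (l : Weight (m + 1)) :
    Tendsto (fun k => orbU (L k)) atTop (𝓝 (orbU l)) ↔ ∀ᶠ k in atTop, L k = l := by
  constructor
  · intro h
    filter_upwards [eventually_formClose h] with k ⟨g, hg⟩
    exact eq_of_formClose g hg
  · intro h
    refine tendsto_const_nhds.congr' ?_
    filter_upwards [h] with k hk
    rw [hk]

theorem tendsto_zero_of_sum_norm_sq {n : ℕ} {u : ℕ → Fin n → ℂ}
    (h : Tendsto (fun k => ∑ i, ‖u k i‖ ^ 2) atTop (𝓝 0)) : Tendsto u atTop (𝓝 0) := by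
  refine tendsto_pi_nhds.2 fun i => ?_
  have h1 : Tendsto (fun k => ‖u k i‖ ^ 2) atTop (𝓝 0) :=
    squeeze_zero (fun k => sq_nonneg _) (fun k => Finset.single_le_sum
      (f := fun i => ‖u k i‖ ^ 2) (fun i _ => sq_nonneg _) (Finset.mem_univ i)) h
  have h2 := (Real.continuous_sqrt.tendsto _).comp h1
  rw [Real.sqrt_zero] at h2
  exact tendsto_zero_iff_norm_tendsto_zero.2 (h2.congr fun k => Real.sqrt_sq (norm_nonneg _))

theorem tendsto_orbMid_orbU (M : ℕ → Weight m) (R : ℕ → {r : ℝ // 0 < r}) (l : Weight (m + 1)) :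
    Tendsto (fun k => orbMid (M k) (R k)) atTop (𝓝 (orbU l)) ↔
      Tendsto (fun k => (R k : ℝ)) atTop (𝓝 0) ∧ ∀ᶠ k in atTop, InterlaceShort l (M k) := by
  constructor
  · intro h
    constructor
    · have h1 := tendsto_traceInv h
      simp only [traceInv_ellMid, traceInv_ellU] at h1
      have h2 := (Real.continuous_sqrt.tendsto _).comp h1
      rw [Real.sqrt_zero] at h2
      exact h2.congr fun k => Real.sqrt_sq (R k).2.le
    · filter_upwards [eventually_formClose h] with k ⟨g, hg⟩
      exact interlaceShort_of_formClose g hg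
  · rintro ⟨hR, hM⟩
    -- Interlacing holds only eventually; at the other indices `u` is an irrelevant default.
    have hex : ∀ k, ∃ u : Fin (m + 1) → ℂ, InterlaceShort l (M k) →
        ((J fun j => (l.1 j : ℝ), u, 0) : LieGDual (m + 1)) ∈
          MulAction.orbit (G (m + 1)) (ellMid (M k) (R k)) ∧ ∑ i, ‖u i‖ ^ 2 = (R k : ℝ) ^ 2 := by
      intro k
      by_cases hk : InterlaceShort l (M k)
      · obtain ⟨u, hu⟩ := exists_mem_orbit_ellMid (R k).2 hk
        exact ⟨u, fun _ => hu⟩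
      · exact ⟨0, fun h => absurd h hk⟩
    choose u hu using hex
    have hu0 : Tendsto u atTop (𝓝 0) := by
      refine tendsto_zero_of_sum_norm_sq ?_
      have h1 : Tendsto (fun k => (R k : ℝ) ^ 2) atTop (𝓝 0) := by simpa using hR.pow 2
      refine h1.congr' ?_
      filter_upwards [hM] with k hk
      exact (hu k hk).2.symm
    exact tendsto_orbit_of_tendsto (fun k => (J fun j => (l.1 j : ℝ), u k, 0))
      (hM.mono fun k hk => (hu k hk).1)
      (tendsto_const_nhds.prodMk_nhds (hu0.prodMk_nhds tendsto_const_nhds))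

/-! ### Splitting by the sign of the central character -/

section Signs

theorem tendsto_iff_pos_neg {a : ℕ → {a : ℝ // a ≠ 0}} {f : ℕ → ℝ} {c : ℝ} :
    Tendsto f atTop (𝓝 c) ↔
      Tendsto f (atTop ⊓ 𝓟 {k | 0 < (a k : ℝ)}) (𝓝 c) ∧
      Tendsto f (atTop ⊓ 𝓟 {k | (a k : ℝ) < 0}) (𝓝 c) := by
  rw [← tendsto_sup, ← inf_sup_left, sup_principal]
  have : {k | 0 < (a k : ℝ)} ∪ {k | (a k : ℝ) < 0} = Set.univ := by
    ext k
    simpa using (lt_or_gt_of_ne (a k).2).symm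
  rw [this, principal_univ, inf_top_eq]

theorem eventually_inf_principal_of {p q : ℕ → Prop} (h : ∀ᶠ k in atTop, p k → q k) :
    ∀ᶠ k in atTop ⊓ 𝓟 {k | p k}, q k :=
  eventually_inf_principal.2 h

theorem tendsto_mul_iff_of_bounded {F : Filter ℕ} {a s x : ℕ → ℝ} {B : ℝ}
    (ha : Tendsto a F (𝓝 0)) (hB : ∀ᶠ k in F, |s k - x k| ≤ B) :
    Tendsto (fun k => a k * s k) F (𝓝 0) ↔ Tendsto (fun k => a k * x k) F (𝓝 0) := by
  have hd : Tendsto (fun k => a k * (s k - x k)) F (𝓝 0) := by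
    refine squeeze_zero_norm' (a := fun k => |a k| * B) ?_ (by simpa using ha.abs.mul_const B)
    filter_upwards [hB] with k hk
    rw [Real.norm_eq_abs, abs_mul]
    exact mul_le_mul_of_nonneg_left hk (abs_nonneg _)
  constructor
  · intro h
    simpa [mul_sub] using h.sub hd
  · intro h
    simpa [mul_sub] using h.add hd

/-- A bound for the partial traces of weights interlacing with `l`. -/
def interlaceBound (l : Weight (m + 1)) : ℝ :=
  ∑ j : Fin m, (|(l.1 j.castSucc : ℝ)| + |(l.1 j.succ : ℝ)|)

theorem abs_sum_le_interlaceBound {l : Weight (m + 1)} {f : Fin m → ℤ}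
    (h1 : ∀ j : Fin m, f j ≤ l.1 j.castSucc) (h2 : ∀ j : Fin m, l.1 j.succ ≤ f j) :
    |∑ j, (f j : ℝ)| ≤ interlaceBound l := by
  refine (Finset.abs_sum_le_sum_abs _ _).trans (Finset.sum_le_sum fun j _ => ?_)
  have h3 : (f j : ℝ) ≤ l.1 j.castSucc := by exact_mod_cast h1 j
  have h4 : (l.1 j.succ : ℝ) ≤ f j := by exact_mod_cast h2 j
  rw [abs_le]
  constructor
  · linarith [neg_abs_le (l.1 j.succ : ℝ), abs_nonneg (l.1 j.castSucc : ℝ)]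
  · linarith [le_abs_self (l.1 j.castSucc : ℝ), abs_nonneg (l.1 j.succ : ℝ)]

theorem abs_sum_sub_last_le {l b : Weight (m + 1)} (h : Interlace l b) :
    |∑ i, (b.1 i : ℝ) - (b.1 (Fin.last m) : ℝ)| ≤ interlaceBound l := by
  rw [Fin.sum_univ_castSucc, add_sub_cancel_right]
  exact abs_sum_le_interlaceBound (fun j => h.1 _) h.2

theorem abs_sum_sub_zero_le {l b : Weight (m + 1)} (h : Interlace b l) :
    |∑ i, (b.1 i : ℝ) - (b.1 0 : ℝ)| ≤ interlaceBound l := by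
  rw [Fin.sum_univ_succ, add_sub_cancel_left]
  exact abs_sum_le_interlaceBound h.2 (fun j => h.1 _)

/-- Interlacing confines all entries but the last (for `a_k > 0`) or the first (for `a_k < 0`) to a
fixed range, so after multiplication by `a_k → 0` only that entry of the trace matters. -/
theorem tendsto_mul_sum_iff {L : ℕ → Weight (m + 1)} {a : ℕ → {a : ℝ // a ≠ 0}}
    {l : Weight (m + 1)} (ha : Tendsto (fun k => (a k : ℝ)) atTop (𝓝 0))
    (hpos : ∀ᶠ k in atTop, 0 < (a k : ℝ) → Interlace l (L k))
    (hneg : ∀ᶠ k in atTop, (a k : ℝ) < 0 → Interlace (L k) l) :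
    Tendsto (fun k => (a k : ℝ) * ∑ i, ((L k).1 i : ℝ)) atTop (𝓝 0) ↔
      Tendsto (fun k => (a k : ℝ) * ((L k).1 (Fin.last m) : ℝ))
        (atTop ⊓ 𝓟 {k | 0 < (a k : ℝ)}) (𝓝 0) ∧
      Tendsto (fun k => (a k : ℝ) * ((L k).1 0 : ℝ))
        (atTop ⊓ 𝓟 {k | (a k : ℝ) < 0}) (𝓝 0) := by
  rw [tendsto_iff_pos_neg (a := a)]
  exact and_congr
    (tendsto_mul_iff_of_bounded (ha.mono_left inf_le_left)
      ((eventually_inf_principal_of hpos).mono fun k => abs_sum_sub_last_le))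
    (tendsto_mul_iff_of_bounded (ha.mono_left inf_le_left)
      ((eventually_inf_principal_of hneg).mono fun k => abs_sum_sub_zero_le))

end Signs

theorem tendsto_orbGen_orbU (L : ℕ → Weight (m + 1)) (a : ℕ → {a : ℝ // a ≠ 0})
    (l : Weight (m + 1)) :
    Tendsto (fun k => orbGen (L k) (a k)) atTop (𝓝 (orbU l)) ↔
      Tendsto (fun k => (a k : ℝ)) atTop (𝓝 0) ∧
      ((∀ᶠ k in atTop, 0 < (a k : ℝ) → Interlace l (L k)) ∧
        Tendsto (fun k => (a k : ℝ) * ((L k).1 (Fin.last m) : ℝ))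
          (atTop ⊓ 𝓟 {k | 0 < (a k : ℝ)}) (𝓝 0)) ∧
      ((∀ᶠ k in atTop, (a k : ℝ) < 0 → Interlace (L k) l) ∧
        Tendsto (fun k => (a k : ℝ) * ((L k).1 0 : ℝ))
          (atTop ⊓ 𝓟 {k | (a k : ℝ) < 0}) (𝓝 0)) := by
  constructor
  · intro h
    have ha : Tendsto (fun k => (a k : ℝ)) atTop (𝓝 0) := tendsto_central h
    have hclose := eventually_formClose h
    have hpos : ∀ᶠ k in atTop, 0 < (a k : ℝ) → Interlace l (L k) := by
      filter_upwards [hclose] with k ⟨g, hg⟩ hk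
      exact interlace_of_formClose_of_pos g hk hg
    have hneg : ∀ᶠ k in atTop, (a k : ℝ) < 0 → Interlace (L k) l := by
      filter_upwards [hclose] with k ⟨g, hg⟩ hk
      exact interlace_of_formClose_of_neg g hk hg
    have hsum : Tendsto (fun k => (a k : ℝ) * ∑ i, ((L k).1 i : ℝ)) atTop (𝓝 0) := by
      have h1 := tendsto_traceInv h
      simp only [traceInv_ellGen, traceInv_ellU] at h1
      have h2 := h1.const_mul (-(1 / 2))
      rw [mul_zero] at h2
      exact h2.congr fun k => by ring
    have := (tendsto_mul_sum_iff ha hpos hneg).1 hsum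
    exact ⟨ha, ⟨hpos, this.1⟩, hneg, this.2⟩
  · rintro ⟨ha, ⟨hpos, hpos'⟩, hneg, hneg'⟩
    have hsum := (tendsto_mul_sum_iff ha hpos hneg).2 ⟨hpos', hneg'⟩
    have hev : ∀ᶠ k in atTop, (0 < (a k : ℝ) ∧ Interlace l (L k)) ∨
        ((a k : ℝ) < 0 ∧ Interlace (L k) l) := by
      filter_upwards [hpos, hneg] with k h1 h2
      rcases lt_or_gt_of_ne (a k).2 with h | h
      · exact Or.inr ⟨h, h2 h⟩
      · exact Or.inl ⟨h, h1 h⟩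
    have hex : ∀ k, ∃ u : Fin (m + 1) → ℂ, ((0 < (a k : ℝ) ∧ Interlace l (L k)) ∨
        ((a k : ℝ) < 0 ∧ Interlace (L k) l)) →
        ((J fun j => (l.1 j : ℝ), u, (a k : ℝ)) : LieGDual (m + 1)) ∈
          MulAction.orbit (G (m + 1)) (ellGen (L k) (a k)) ∧
        ∑ i, ‖u i‖ ^ 2 = 2 * a k * (∑ i, (l.1 i : ℝ) - ∑ i, ((L k).1 i : ℝ)) := by
      intro k
      by_cases hk : (0 < (a k : ℝ) ∧ Interlace l (L k)) ∨ ((a k : ℝ) < 0 ∧ Interlace (L k) l)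
      · obtain ⟨u, hu⟩ := exists_mem_orbit_ellGen (a k).2 hk
        exact ⟨u, fun _ => hu⟩
      · exact ⟨0, fun h => absurd h hk⟩
    choose u hu using hex
    have hu0 : Tendsto u atTop (𝓝 0) := by
      refine tendsto_zero_of_sum_norm_sq ?_
      -- `|u_k|²` is twice `a_k` times the difference of the traces, and both products tend to zero.
      have h1 := ((ha.mul_const (∑ i, (l.1 i : ℝ))).sub hsum).const_mul 2
      rw [zero_mul, sub_zero, mul_zero] at h1
      refine h1.congr' ?_
      filter_upwards [hev] with k hk
      rw [(hu k hk).2]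
      ring
    exact tendsto_orbit_of_tendsto (fun k => (J fun j => (l.1 j : ℝ), u k, (a k : ℝ)))
      (hev.mono fun k hk => (hu k hk).1)
      (tendsto_const_nhds.prodMk_nhds (hu0.prodMk_nhds ha))

/-! ### Weights with one entry outside a fixed weight -/

section OneEscapingEntry

theorem entries_snoc (f : Fin m → ℤ) (s : ℤ) :
    Finset.univ.val.map (Fin.snoc (α := fun _ => ℤ) f s) = s ::ₘ entries f := by
  rw [entries, Fin.univ_val_map, Fin.univ_val_map, List.ofFn_succ', List.concat_eq_append,
    ← Multiset.coe_add, add_comm]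
  simp

theorem entries_cons (f : Fin m → ℤ) (s : ℤ) :
    Finset.univ.val.map (Fin.cons (α := fun _ => ℤ) s f) = s ::ₘ entries f := by
  rw [entries, Fin.univ_val_map, Fin.univ_val_map, List.ofFn_succ]
  simp

theorem antitone_snoc {f : Fin m → ℤ} (hf : Antitone f) {s : ℤ} (hs : ∀ j, s ≤ f j) :
    Antitone (Fin.snoc (α := fun _ => ℤ) f s) := by
  intro i j hij
  induction j using Fin.lastCases with
  | last => induction i using Fin.lastCases <;> simp [hs]
  | cast j =>
    induction i using Fin.lastCases with
    | last => exact absurd hij (not_le.2 (Fin.castSucc_lt_last j))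
    | cast i => simpa using hf (by simpa using hij)

theorem antitone_cons {f : Fin m → ℤ} (hf : Antitone f) {s : ℤ} (hs : ∀ j, f j ≤ s) :
    Antitone (Fin.cons (α := fun _ => ℤ) s f) := by
  intro i j hij
  induction i using Fin.cases with
  | zero => induction j using Fin.cases <;> simp [hs]
  | succ i =>
    induction j using Fin.cases with
    | zero => exact absurd hij (not_le.2 (Fin.succ_pos i))
    | succ j => simpa using hf (by simpa using hij)

/-- The difference of the traces of `b` and `mu`. -/
def extraEntry (b : Weight (m + 1)) (mu : Weight m) : ℤ := ∑ i, b.1 i - ∑ j, mu.1 j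

/-- By cardinality exactly one entry is left over, and comparing sums identifies it. -/
theorem entries_eq_cons {b : Weight (m + 1)} {mu : Weight m} (h : entries mu.1 ≤ entries b.1) :
    entries b.1 = extraEntry b mu ::ₘ entries mu.1 := by
  obtain ⟨S, hS⟩ := Multiset.le_iff_exists_add.1 h
  have hcard := congrArg Multiset.card hS
  rw [Multiset.card_add, card_entries, card_entries] at hcard
  obtain ⟨s, rfl⟩ := Multiset.card_eq_one.1 (show S.card = 1 by omega)
  have hsum := congrArg Multiset.sum hS
  rw [Multiset.sum_add, Multiset.sum_singleton] at hsum
  have hs : extraEntry b mu = s := by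
    change (entries b.1).sum - (entries mu.1).sum = s
    omega
  rw [hs, hS, add_comm]
  rfl

theorem extraEntry_of_castSucc {b : Weight (m + 1)} {mu : Weight m}
    (h : ∀ j : Fin m, b.1 j.castSucc = mu.1 j) : extraEntry b mu = b.1 (Fin.last m) := by
  simp [extraEntry, Fin.sum_univ_castSucc, h]

theorem extraEntry_of_succ {b : Weight (m + 1)} {mu : Weight m}
    (h : ∀ j : Fin m, b.1 j.succ = mu.1 j) : extraEntry b mu = b.1 0 := by
  simp [extraEntry, Fin.sum_univ_succ, h]

theorem prod_eq_of_castSucc {b : Weight (m + 1)} {mu : Weight m}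
    (h : ∀ j : Fin m, b.1 j.castSucc = mu.1 j) (t : ℝ) :
    ∏ i, (t - (b.1 i : ℝ)) = (t - extraEntry b mu) * ∏ j, (t - (mu.1 j : ℝ)) := by
  rw [extraEntry_of_castSucc h, Fin.prod_univ_castSucc, mul_comm]
  simp [h]

theorem prod_eq_of_succ {b : Weight (m + 1)} {mu : Weight m}
    (h : ∀ j : Fin m, b.1 j.succ = mu.1 j) (t : ℝ) :
    ∏ i, (t - (b.1 i : ℝ)) = (t - extraEntry b mu) * ∏ j, (t - (mu.1 j : ℝ)) := by
  rw [extraEntry_of_succ h, Fin.prod_univ_succ]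
  simp [h]

theorem castSucc_eq_of_entries {b : Weight (m + 1)} {mu : Weight m}
    (h : entries b.1 = extraEntry b mu ::ₘ entries mu.1) (hs : ∀ j, extraEntry b mu ≤ mu.1 j)
    (j : Fin m) : b.1 j.castSucc = mu.1 j := by
  have := antitone_eq_of_map_eq b.2 (antitone_snoc mu.2 hs) (h.trans (entries_snoc _ _).symm)
  rw [this, Fin.snoc_castSucc]

theorem succ_eq_of_entries {b : Weight (m + 1)} {mu : Weight m}
    (h : entries b.1 = extraEntry b mu ::ₘ entries mu.1) (hs : ∀ j, mu.1 j ≤ extraEntry b mu)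
    (j : Fin m) : b.1 j.succ = mu.1 j := by
  have := antitone_eq_of_map_eq b.2 (antitone_cons mu.2 hs) (h.trans (entries_cons _ _).symm)
  rw [this, Fin.cons_succ]

end OneEscapingEntry

/-- All roots `μ_j` eventually occur in `λ^k`, leaving one entry `s_k`. The sign of `a_k` decides at
which end of `λ^k` it stands, so both cases reduce to the single limit of `a_k s_k`. -/
theorem tendsto_orbGen_orbMid (L : ℕ → Weight (m + 1)) (a : ℕ → {a : ℝ // a ≠ 0})
    (mu : Weight m) (r : {r : ℝ // 0 < r}) :
    Tendsto (fun k => orbGen (L k) (a k)) atTop (𝓝 (orbMid mu r)) ↔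
      Tendsto (fun k => (a k : ℝ)) atTop (𝓝 0) ∧
      ((∀ᶠ k in atTop, 0 < (a k : ℝ) → ∀ j : Fin m, (L k).1 j.castSucc = mu.1 j) ∧
        Tendsto (fun k => (a k : ℝ) * ((L k).1 (Fin.last m) : ℝ))
          (atTop ⊓ 𝓟 {k | 0 < (a k : ℝ)}) (𝓝 (-(r : ℝ) ^ 2 / 2))) ∧
      ((∀ᶠ k in atTop, (a k : ℝ) < 0 → ∀ j : Fin m, (L k).1 j.succ = mu.1 j) ∧
        Tendsto (fun k => (a k : ℝ) * ((L k).1 0 : ℝ))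
          (atTop ⊓ 𝓟 {k | (a k : ℝ) < 0}) (𝓝 (-(r : ℝ) ^ 2 / 2))) := by
  have hsplit : (∀ᶠ k in atTop, 0 < (a k : ℝ) → ∀ j : Fin m, (L k).1 j.castSucc = mu.1 j) →
      (∀ᶠ k in atTop, (a k : ℝ) < 0 → ∀ j : Fin m, (L k).1 j.succ = mu.1 j) →
      (Tendsto (fun k => (a k : ℝ) * (extraEntry (L k) mu : ℝ)) atTop (𝓝 (-(r : ℝ) ^ 2 / 2)) ↔
        Tendsto (fun k => (a k : ℝ) * ((L k).1 (Fin.last m) : ℝ))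
          (atTop ⊓ 𝓟 {k | 0 < (a k : ℝ)}) (𝓝 (-(r : ℝ) ^ 2 / 2)) ∧
        Tendsto (fun k => (a k : ℝ) * ((L k).1 0 : ℝ))
          (atTop ⊓ 𝓟 {k | (a k : ℝ) < 0}) (𝓝 (-(r : ℝ) ^ 2 / 2))) := by
    intro hpos hneg
    rw [tendsto_iff_pos_neg (a := a)]
    exact and_congr
      (tendsto_congr' ((eventually_inf_principal_of hpos).mono fun k hk => by
        simp only [extraEntry_of_castSucc hk]))
      (tendsto_congr' ((eventually_inf_principal_of hneg).mono fun k hk => by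
        simp only [extraEntry_of_succ hk]))
  have hr2 : 0 < (r : ℝ) ^ 2 := pow_pos r.2 2
  constructor
  · intro h
    have ha : Tendsto (fun k => (a k : ℝ)) atTop (𝓝 0) := tendsto_central h
    have hdet : ∀ t : ℝ, Tendsto (fun k => 2 * (a k : ℝ) * rootProd (entries (L k).1) t) atTop
        (𝓝 ((r : ℝ) ^ 2 * rootProd (entries mu.1) t)) := by
      intro t
      have := tendsto_detInv t h
      simpa only [detInv_ellGen, detInv_ellMid, Complex.ofReal_re, rootProd_entries] using this
    have hent : ∀ᶠ k in atTop, entries (L k).1 = extraEntry (L k) mu ::ₘ entries mu.1 :=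
      (eventually_le_of_tendsto (entries mu.1) (S := fun k => entries (L k).1) hr2.ne'
        (N := m + 1) (by simp) fun t _ => hdet t).mono fun k => entries_eq_cons
    have hlim : Tendsto (fun k => (a k : ℝ) * (extraEntry (L k) mu : ℝ)) atTop
        (𝓝 (-(r : ℝ) ^ 2 / 2)) := by
      -- Any nonintegral `t` would do: dividing `2 a_k (t - s_k) ∏ (t - μ_j)` by twice the product
      -- and subtracting from `a_k t` isolates `a_k s_k`.
      have hne : rootProd (entries mu.1) (1 / 2) ≠ 0 :=
        rootProd_ne_zero _ fun b => by
          simpa using not_int_of_between (b := 0) (e := 1 / 2) (by norm_num) (by norm_num) b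
      have h1 := (ha.mul_const (1 / 2)).sub
        ((hdet (1 / 2)).mul_const ((rootProd (entries mu.1) (1 / 2))⁻¹ / 2))
      have hval : 0 * (1 / 2) - (r : ℝ) ^ 2 * rootProd (entries mu.1) (1 / 2) *
          ((rootProd (entries mu.1) (1 / 2))⁻¹ / 2) = -(r : ℝ) ^ 2 / 2 := by
        field_simp
        ring
      rw [hval] at h1
      refine h1.congr' ?_
      filter_upwards [hent] with k hk
      rw [hk, rootProd_cons]
      field_simp
      ring
    obtain ⟨B, hB⟩ : ∃ B : ℝ, ∀ j, |(mu.1 j : ℝ)| ≤ B := by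
      obtain ⟨B, hB⟩ := (Set.finite_range fun j => |(mu.1 j : ℝ)|).bddAbove
      exact ⟨B, fun j => hB (Set.mem_range_self j)⟩
    -- Eventually `a_k s_k < -r²/4 < -|a_k| B`, so `s_k` lies below every `μ_j` if `a_k > 0` and
    -- above every `μ_j` if `a_k < 0`.
    have h1 : ∀ᶠ k in atTop, (a k : ℝ) * (extraEntry (L k) mu : ℝ) < -(r : ℝ) ^ 2 / 4 :=
      hlim.eventually_lt_const (by linarith)
    have h2 : ∀ᶠ k in atTop, |(a k : ℝ)| * B < (r : ℝ) ^ 2 / 4 :=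
      (ha.abs.mul_const B).eventually_lt_const (by simpa using hr2)
    have hpos : ∀ᶠ k in atTop, 0 < (a k : ℝ) → ∀ j : Fin m, (L k).1 j.castSucc = mu.1 j := by
      filter_upwards [hent, h1, h2] with k h3 h4 h5 hk
      refine castSucc_eq_of_entries h3 fun j => ?_
      rw [abs_of_pos hk] at h5
      have h6 : (a k : ℝ) * extraEntry (L k) mu < (a k : ℝ) * (-B) := by linarith
      have h7 := lt_of_mul_lt_mul_left h6 hk.le
      have h8 := (abs_le.1 (hB j)).1
      exact_mod_cast (h7.le.trans h8)
    have hneg : ∀ᶠ k in atTop, (a k : ℝ) < 0 → ∀ j : Fin m, (L k).1 j.succ = mu.1 j := by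
      filter_upwards [hent, h1, h2] with k h3 h4 h5 hk
      refine succ_eq_of_entries h3 fun j => ?_
      rw [abs_of_neg hk] at h5
      have h6 : -(a k : ℝ) * B < -(a k : ℝ) * extraEntry (L k) mu := by linarith
      have h7 := lt_of_mul_lt_mul_left h6 (by linarith)
      have h8 := (abs_le.1 (hB j)).2
      exact_mod_cast (h8.trans h7.le)
    have := (hsplit hpos hneg).1 hlim
    exact ⟨ha, ⟨hpos, this.1⟩, hneg, this.2⟩
  · rintro ⟨ha, ⟨hpos, hpos'⟩, hneg, hneg'⟩
    have hlim := (hsplit hpos hneg).2 ⟨hpos', hneg'⟩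
    -- With `ρ² = -2 a s` the factor `2at + ρ²` of the invariant becomes `2a(t - s)`, so the point
    -- with vector part `ρ e_n` lies on the given orbit.
    let ρ : ℕ → ℝ := fun k => Real.sqrt (-2 * ((a k : ℝ) * (extraEntry (L k) mu : ℝ)))
    have hρ : Tendsto ρ atTop (𝓝 (r : ℝ)) := by
      have h1 := (Real.continuous_sqrt.tendsto _).comp (hlim.const_mul (-2))
      have h2 : -2 * (-(r : ℝ) ^ 2 / 2) = (r : ℝ) ^ 2 := by ring
      rwa [h2, Real.sqrt_sq r.2.le] at h1
    have hnonneg : ∀ᶠ k in atTop, (a k : ℝ) * (extraEntry (L k) mu : ℝ) < 0 :=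
      hlim.eventually_lt_const (by linarith)
    have hsingle : Continuous fun s : ℝ => (Pi.single (Fin.last m) (s : ℂ) : Fin (m + 1) → ℂ) :=
      (continuous_single _).comp Complex.continuous_ofReal
    refine tendsto_orbit_of_tendsto
      (fun k => (J (Fin.snoc (α := fun _ => ℝ) (fun j => (mu.1 j : ℝ)) 0),
        Pi.single (Fin.last m) (ρ k : ℂ), (a k : ℝ))) ?_
      (tendsto_const_nhds.prodMk_nhds (((hsingle.tendsto _).comp hρ).prodMk_nhds ha))
    filter_upwards [hpos, hneg, hnonneg] with k h1 h2 h3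
    refine mem_orbit_ellGen (a k).2 fun t => ?_
    have hprod : ∏ i, (t - ((L k).1 i : ℝ)) =
        (t - extraEntry (L k) mu) * ∏ j, (t - (mu.1 j : ℝ)) := by
      rcases lt_or_gt_of_ne (a k).2 with h | h
      · exact prod_eq_of_succ (h2 h) t
      · exact prod_eq_of_castSucc (h1 h) t
    have hsq : ρ k ^ 2 = -2 * ((a k : ℝ) * (extraEntry (L k) mu : ℝ)) :=
      Real.sq_sqrt (by linarith)
    rw [detInv_snoc_single, hprod, hsq]
    congr 1
    ring

end Limits

end HeisenbergMotion

end

open HeisenbergMotion in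
/-- Here `n = m + 1 ≥ 1`; the filter `atTop ⊓ 𝓟 S` expresses a limit as `k → ∞` along `k ∈ S`
(no condition if `S` is finite). -/
theorem theorem3p4 (m : ℕ) :
    -- limits of type `O_{(λ,α)}`
    (∀ (L : ℕ → Weight (m + 1)) (a : ℕ → {a : ℝ // a ≠ 0})
        (l : Weight (m + 1)) (a₀ : {a : ℝ // a ≠ 0}),
      Tendsto (fun k => orbGen (L k) (a k)) atTop (𝓝 (orbGen l a₀)) ↔
        Tendsto (fun k => (a k : ℝ)) atTop (𝓝 (a₀ : ℝ)) ∧ ∀ᶠ k in atTop, L k = l) ∧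
    -- `O_{(λ^k,α_k)} → O_{(μ,r)}`
    (∀ (L : ℕ → Weight (m + 1)) (a : ℕ → {a : ℝ // a ≠ 0})
        (mu : Weight m) (r : {r : ℝ // 0 < r}),
      Tendsto (fun k => orbGen (L k) (a k)) atTop (𝓝 (orbMid mu r)) ↔
        Tendsto (fun k => (a k : ℝ)) atTop (𝓝 0) ∧
        ((∀ᶠ k in atTop, 0 < (a k : ℝ) → ∀ j : Fin m, (L k).1 j.castSucc = mu.1 j) ∧
          Tendsto (fun k => (a k : ℝ) * ((L k).1 (Fin.last m) : ℝ))
            (atTop ⊓ 𝓟 {k | 0 < (a k : ℝ)}) (𝓝 (-(r : ℝ) ^ 2 / 2))) ∧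
        ((∀ᶠ k in atTop, (a k : ℝ) < 0 → ∀ j : Fin m, (L k).1 j.succ = mu.1 j) ∧
          Tendsto (fun k => (a k : ℝ) * ((L k).1 0 : ℝ))
            (atTop ⊓ 𝓟 {k | (a k : ℝ) < 0}) (𝓝 (-(r : ℝ) ^ 2 / 2)))) ∧
    -- `O_{(λ^k,α_k)} → O_λ`
    (∀ (L : ℕ → Weight (m + 1)) (a : ℕ → {a : ℝ // a ≠ 0}) (l : Weight (m + 1)),
      Tendsto (fun k => orbGen (L k) (a k)) atTop (𝓝 (orbU l)) ↔
        Tendsto (fun k => (a k : ℝ)) atTop (𝓝 0) ∧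
        ((∀ᶠ k in atTop, 0 < (a k : ℝ) → Interlace l (L k)) ∧
          Tendsto (fun k => (a k : ℝ) * ((L k).1 (Fin.last m) : ℝ))
            (atTop ⊓ 𝓟 {k | 0 < (a k : ℝ)}) (𝓝 0)) ∧
        ((∀ᶠ k in atTop, (a k : ℝ) < 0 → Interlace (L k) l) ∧
          Tendsto (fun k => (a k : ℝ) * ((L k).1 0 : ℝ))
            (atTop ⊓ 𝓟 {k | (a k : ℝ) < 0}) (𝓝 0))) ∧
    -- `O_{(μ^k,r_k)} → O_{(μ,r)}`
    (∀ (M : ℕ → Weight m) (R : ℕ → {r : ℝ // 0 < r}) (mu : Weight m) (r : {r : ℝ // 0 < r}),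
      Tendsto (fun k => orbMid (M k) (R k)) atTop (𝓝 (orbMid mu r)) ↔
        Tendsto (fun k => (R k : ℝ)) atTop (𝓝 (r : ℝ)) ∧ ∀ᶠ k in atTop, M k = mu) ∧
    -- `O_{(μ^k,r_k)} → O_λ`
    (∀ (M : ℕ → Weight m) (R : ℕ → {r : ℝ // 0 < r}) (l : Weight (m + 1)),
      Tendsto (fun k => orbMid (M k) (R k)) atTop (𝓝 (orbU l)) ↔
        Tendsto (fun k => (R k : ℝ)) atTop (𝓝 0) ∧ ∀ᶠ k in atTop, InterlaceShort l (M k)) ∧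
    -- `O_{λ^k} → O_λ`
    (∀ (L : ℕ → Weight (m + 1)) (l : Weight (m + 1)),
      Tendsto (fun k => orbU (L k)) atTop (𝓝 (orbU l)) ↔ ∀ᶠ k in atTop, L k = l) := by
  exact ⟨tendsto_orbGen_orbGen, tendsto_orbGen_orbMid, tendsto_orbGen_orbU,
    tendsto_orbMid_orbMid, tendsto_orbMid_orbU, tendsto_orbU_orbU⟩
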